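/- Let $\mathscr S$ be the category of abelian sheaves on an arbitrary (small) site, with tensor product the sheafification of the presheaf tensor product $U\mapsto A(U)\otimes_{\mathbb Z}B(U)$. A sheaf $P$ is flat if $-\otimes P$ is exact. For complexes $X,Y$ in $\mathscr S$ (possibly unbounded) write $H_s(X)=H^{-s}(X)$. A flat resolution of $Y$ is a quasi-isomorphism $P\to Y$ from a complex of flat sheaves, and $X\otimes^L Y$ is computed as the total complex $X\otimes P$; for sheaves $A,B$, regarded as complexes in degree $0$, $\mathrm{Tor}_r(A,B)=H_r(A\otimes^L B)$. Then the Tor-dimension of $\mathscr S$ is at most $1$: every sheaf $G$ has an exact sequence $0\to P_1\to P_0\to G\to 0$ with $P_0,P_1$ flat. Every complex has a flat resolution. Moreover, for every choice of flat resolutions of all complexes, used to compute $\otimes^L$ and $\mathrm{Tor}$, the following holds. (1) $\mathrm{Tor}_r(A,B)=0$ for $r\neq 0,1$, and the canonical product map $A\otimes B\to \mathrm{Tor}_0(A,B)$ is an isomorphism, for all sheaves $A,B$. (2) For all complexes $X,Y$ there is a homological (Künneth) spectral sequence, with differentials $d^r\colon E^r_{p,q}\to E^r_{p-r,q+r-1}$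 for $r\ge 2$, $$E^2_{r,s}=\bigoplus_{s_1+s_2=s}\mathrm{Tor}_r\bigl(H_{s_1}(X),H_{s_2}(Y)\bigr)\Longrightarrow H_{r+s}(X\otimes^L Y)\qquad(r,s\in\mathbb Z),$$ convergent in the sense that every $H_n(X\otimes^L Y)$ has a finite increasing filtration $F_p$ with $F_p/F_{p-1}\cong E^\infty_{p,n-p}$. (3) This spectral sequence collapses at $E^2$ (all differentials vanish), and for every $n\in\mathbb Z$ its edge morphisms form a short exact sequence $$0\to\bigoplus_{s_1+s_2=n}H_{s_1}(X)\otimes H_{s_2}(Y)\to H_n(X\otimes^L Y)\to\bigoplus_{s_1+s_2=n-1}\mathrm{Tor}_1\bigl(H_{s_1}(X),H_{s_2}(Y)\bigr)\to 0,$$ whose first map (using the isomorphism $\mathrm{Tor}_0\cong\otimes$ of (1)) is on each summand the canonical product map induced by the tensor product of cycles. -/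

import Mathlib

open CategoryTheory Limits

universe w v u

namespace Kunneth

noncomputable section

/-! ### The tensor product of abelian groups, of abelian presheaves and of abelian sheaves -/

/-- The tensor product `A ⊗_ℤ B` of abelian groups. -/
abbrev tensorAb (A B : AddCommGrpCat.{w}) : AddCommGrpCat.{w} :=
  AddCommGrpCat.of (TensorProduct ℤ A B)

/-- The tensor product `f ⊗ g` of two homomorphisms of abelian groups. -/
def tensorAbMap {A A' B B' : AddCommGrpCat.{w}} (f : A ⟶ A') (g : B ⟶ B') :
    tensorAb A B ⟶ tensorAb A' B' :=
  AddCommGrpCat.ofHom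
    (TensorProduct.map f.hom.toIntLinearMap g.hom.toIntLinearMap).toAddMonoidHom

lemma tensorAb_hom_ext {A B : AddCommGrpCat.{w}} {T : AddCommGrpCat.{w}}
    {f g : tensorAb A B ⟶ T}
    (h : ∀ (a : A) (b : B), f.hom (a ⊗ₜ[ℤ] b) = g.hom (a ⊗ₜ[ℤ] b)) : f = g := by
  ext x
  induction x using TensorProduct.induction_on with
  | zero => rw [map_zero, map_zero]
  | tmul a b => exact h a b
  | add x y hx hy => rw [map_add, map_add, hx, hy]

lemma tensorAbMap_id (A B : AddCommGrpCat.{w}) : tensorAbMap (𝟙 A) (𝟙 B) = 𝟙 _ :=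
  tensorAb_hom_ext fun _ _ => rfl

lemma tensorAbMap_comp {A A' A'' B B' B'' : AddCommGrpCat.{w}} (f : A ⟶ A') (f' : A' ⟶ A'')
    (g : B ⟶ B') (g' : B' ⟶ B'') :
    tensorAbMap (f ≫ f') (g ≫ g') = tensorAbMap f g ≫ tensorAbMap f' g' :=
  tensorAb_hom_ext fun _ _ => rfl

lemma tensorAbMap_add_left {A A' B B' : AddCommGrpCat.{w}} (f f' : A ⟶ A') (g : B ⟶ B') :
    tensorAbMap (f + f') g = tensorAbMap f g + tensorAbMap f' g :=
  tensorAb_hom_ext fun _ _ => TensorProduct.add_tmul _ _ _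

lemma tensorAbMap_add_right {A A' B B' : AddCommGrpCat.{w}} (f : A ⟶ A') (g g' : B ⟶ B') :
    tensorAbMap f (g + g') = tensorAbMap f g + tensorAbMap f g' :=
  tensorAb_hom_ext fun _ _ => TensorProduct.tmul_add _ _ _

/-- The tensor product of abelian presheaves, computed objectwise:
`(F ⊗ G)(U) = F(U) ⊗_ℤ G(U)`. -/
def tensorPsh (C : Type u) [Category.{v} C] :
    (Cᵒᵖ ⥤ AddCommGrpCat.{w}) ⥤ (Cᵒᵖ ⥤ AddCommGrpCat.{w}) ⥤ (Cᵒᵖ ⥤ AddCommGrpCat.{w}) where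
  obj F :=
    { obj := fun G =>
        { obj := fun U => tensorAb (F.obj U) (G.obj U)
          map := fun i => tensorAbMap (F.map i) (G.map i)
          map_id := fun U => by rw [F.map_id, G.map_id, tensorAbMap_id]
          map_comp := fun i j => by rw [F.map_comp, G.map_comp, tensorAbMap_comp] }
      map := fun {G G'} g =>
        { app := fun U => tensorAbMap (𝟙 (F.obj U)) (g.app U)
          naturality := fun U V i => by
            simp only [← tensorAbMap_comp, g.naturality, Category.id_comp, Category.comp_id] }
      map_id := fun G => NatTrans.ext (funext fun U => tensorAbMap_id _ _)
      map_comp := fun g g' => NatTrans.ext (funext fun U => by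
        simp only [NatTrans.comp_app, ← tensorAbMap_comp, Category.id_comp]) }
  map {F F'} f :=
    { app := fun G =>
        { app := fun U => tensorAbMap (f.app U) (𝟙 (G.obj U))
          naturality := fun U V i => by
            simp only [← tensorAbMap_comp, f.naturality, Category.id_comp, Category.comp_id] }
      naturality := fun G G' g => NatTrans.ext (funext fun U => by
        simp only [NatTrans.comp_app, ← tensorAbMap_comp, Category.id_comp, Category.comp_id]) }
  map_id F := NatTrans.ext (funext fun G => NatTrans.ext (funext fun U => tensorAbMap_id _ _))
  map_comp f f' := NatTrans.ext (funext fun G => NatTrans.ext (funext fun U => by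
    simp only [NatTrans.comp_app, ← tensorAbMap_comp, Category.id_comp]))

instance (C : Type u) [Category.{v} C] : (tensorPsh.{w} C).Additive where
  map_add := NatTrans.ext (funext fun _ => NatTrans.ext (funext fun _ =>
    tensorAbMap_add_left _ _ _))

instance (C : Type u) [Category.{v} C] (F : Cᵒᵖ ⥤ AddCommGrpCat.{w}) :
    ((tensorPsh.{w} C).obj F).Additive where
  map_add := NatTrans.ext (funext fun _ => tensorAbMap_add_right _ _ _)

variable {C : Type u} [Category.{v} C] (J : GrothendieckTopology C)

/-- The category of abelian sheaves on a site. -/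
abbrev AbSheaf := Sheaf J AddCommGrpCat.{max u v}

/-- The tensor product of abelian sheaves: the sheafification of the tensor product of the
underlying presheaves. -/
def tensorSh : AbSheaf J ⥤ AbSheaf J ⥤ AbSheaf J where
  obj A := sheafToPresheaf J _ ⋙ (tensorPsh C).obj ((sheafToPresheaf J _).obj A) ⋙
    presheafToSheaf J _
  map f := Functor.whiskerLeft _
    (Functor.whiskerRight ((tensorPsh C).map ((sheafToPresheaf J _).map f)) _)

instance : (tensorSh J).Additive where
  map_add {_ _ f g} := NatTrans.ext (funext fun B =>
    (congrArg (fun h => (presheafToSheaf J _).map (NatTrans.app h ((sheafToPresheaf J _).obj B)))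
      ((tensorPsh C).map_add (f := (sheafToPresheaf J _).map f)
        (g := (sheafToPresheaf J _).map g))).trans
      ((presheafToSheaf J AddCommGrpCat.{max u v}).map_add))

instance (A : AbSheaf J) : ((tensorSh J).obj A).Additive :=
  inferInstanceAs (sheafToPresheaf J _ ⋙ (tensorPsh C).obj ((sheafToPresheaf J _).obj A) ⋙
    presheafToSheaf J _).Additive

instance (ι : Type) : HasCoproductsOfShape ι (AbSheaf J) :=
  haveI : HasColimitsOfSize.{0, 0} (AbSheaf J) := Sheaf.instHasColimitsOfSize
  HasColimitsOfSize.has_colimits_of_shape (Discrete ι)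

variable {J}

/-- The tensor product `A ⊗ B` of abelian sheaves. -/
abbrev tens (A B : AbSheaf J) : AbSheaf J := ((tensorSh J).obj A).obj B

/-- The tensor product `f ⊗ g` of two morphisms of abelian sheaves. -/
abbrev tensMap {A A' B B' : AbSheaf J} (f : A ⟶ A') (g : B ⟶ B') : tens A B ⟶ tens A' B' :=
  ((tensorSh J).map f).app B ≫ ((tensorSh J).obj A').map g

/-- An abelian sheaf `P` is flat if the functor `- ⊗ P` is exact. -/
def IsFlat (P : AbSheaf J) : Prop :=
  ∀ (S : ShortComplex (AbSheaf J)), S.ShortExact →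
    (S.map ((tensorSh J).flip.obj P)).ShortExact

/-! ### Complexes, the derived tensor product and Tor -/

/-- The total tensor product complex: in degree `n` it is `⨁_{i + j = n} Xⁱ ⊗ Yʲ`, and the
differential is `d ⊗ 1 + (-1)ⁱ (1 ⊗ d)` on `Xⁱ ⊗ Yʲ`. -/
abbrev tensComplex (X Y : CochainComplex (AbSheaf J) ℤ) : CochainComplex (AbSheaf J) ℤ :=
  HomologicalComplex.mapBifunctor X Y (tensorSh J) (ComplexShape.up ℤ)

/-- Homology in homological indexing: `H_s(X) = H^{-s}(X)`. -/
abbrev hl (X : CochainComplex (AbSheaf J) ℤ) (s : ℤ) : AbSheaf J := X.homology (-s)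

/-- A flat resolution of a (possibly unbounded) complex `Y` of abelian sheaves: a
quasi-isomorphism `P ⟶ Y` where all terms of `P` are flat. -/
structure FlatResolution (Y : CochainComplex (AbSheaf J) ℤ) where
  /-- the resolving complex -/
  P : CochainComplex (AbSheaf J) ℤ
  /-- the augmentation -/
  π : P ⟶ Y
  flat (i : ℤ) : IsFlat (P.X i)
  quasiIso : QuasiIso π

/-- The derived tensor product `X ⊗ᴸ Y`, computed as `X ⊗ P` with the chosen flat resolution
`P ⟶ Y`. -/
abbrev dtens (R : ∀ Y : CochainComplex (AbSheaf J) ℤ, FlatResolution Y)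
    (X Y : CochainComplex (AbSheaf J) ℤ) : CochainComplex (AbSheaf J) ℤ :=
  tensComplex X (R Y).P

/-- An abelian sheaf, regarded as a complex concentrated in degree `0`. -/
abbrev sgl (A : AbSheaf J) : CochainComplex (AbSheaf J) ℤ :=
  (HomologicalComplex.single (AbSheaf J) (ComplexShape.up ℤ) 0).obj A

/-- `Tor_r(A, B) = H_r(A ⊗ᴸ B)` for abelian sheaves `A` and `B` and `r : ℤ`. -/
abbrev tor (R : ∀ Y : CochainComplex (AbSheaf J) ℤ, FlatResolution Y) (r : ℤ)
    (A B : AbSheaf J) : AbSheaf J :=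
  hl (dtens R (sgl A) (sgl B)) r

/-- `φ : Hⁱ(X) ⊗ Hʲ(Y) ⟶ Hⁿ(X ⊗ᴸ Y)`, where `i + j = n`, is the canonical product map: with
`X ⊗ᴸ Y = X ⊗ P`, it is induced by the tensor product of cycles
`Zⁱ(X) ⊗ Zʲ(P) ⟶ Zⁿ(X ⊗ P)` and the identification `Hʲ(P) ≅ Hʲ(Y)`. -/
def IsProductMap (R : ∀ Y : CochainComplex (AbSheaf J) ℤ, FlatResolution Y)
    (X Y : CochainComplex (AbSheaf J) ℤ) (i j n : ℤ) (h : i + j = n)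
    (φ : tens (X.homology i) (Y.homology j) ⟶ (dtens R X Y).homology n) : Prop :=
  ∃ z : tens (X.cycles i) ((R Y).P.cycles j) ⟶ (dtens R X Y).cycles n,
    z ≫ (dtens R X Y).iCycles n =
      tensMap (X.iCycles i) ((R Y).P.iCycles j) ≫
        HomologicalComplex.ιMapBifunctor X (R Y).P (tensorSh J) (ComplexShape.up ℤ) i j n h ∧
    tensMap (X.homologyπ i)
        ((R Y).P.homologyπ j ≫ HomologicalComplex.homologyMap (R Y).π j) ≫ φ =
      z ≫ (dtens R X Y).homologyπ n

/-- `⨁_{s₁ + s₂ = s} Tor_r(H_{s₁}(X), H_{s₂}(Y))`. -/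
abbrev torSum (R : ∀ Y : CochainComplex (AbSheaf J) ℤ, FlatResolution Y)
    (X Y : CochainComplex (AbSheaf J) ℤ) (r s : ℤ) : AbSheaf J :=
  ∐ fun p : {p : ℤ × ℤ // p.1 + p.2 = s} => tor R r (hl X p.1.1) (hl Y p.1.2)

/-- `⨁_{s₁ + s₂ = s} H_{s₁}(X) ⊗ H_{s₂}(Y)`. -/
abbrev tensSum (X Y : CochainComplex (AbSheaf J) ℤ) (s : ℤ) : AbSheaf J :=
  ∐ fun p : {p : ℤ × ℤ // p.1 + p.2 = s} => tens (hl X p.1.1) (hl Y p.1.2)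

/-! ### Homological spectral sequences and their convergence -/

/-- A homological spectral sequence starting at the second page: the differential of the page
`Eʳ` maps `Eʳ_{p,q}` to `Eʳ_{p-r,q+r-1}`. -/
abbrev HomologicalSpectralSequence (A : Type u) [Category.{v} A] [Abelian A] :=
  SpectralSequence A (fun r : ℤ => ComplexShape.up' ((-r, r - 1) : ℤ × ℤ)) 2

/-- Convergence `E²_{p,q} ⇒ H_{p+q}` of a homological spectral sequence: every position becomes
stationary, and each `H_n` has a finite increasing filtration whose graded pieces are the
`E^∞_{p,q}` with `p + q = n`. -/
structure Convergence {A : Type u} [Category.{v} A] [Abelian A]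
    (E : HomologicalSpectralSequence A) (H : ℤ → A) where
  /-- the page from which on the differentials at a given position vanish -/
  N : ℤ × ℤ → ℤ
  two_le (a : ℤ × ℤ) : 2 ≤ N a
  d_to (a b : ℤ × ℤ) (r : ℤ) (hr : N a ≤ r) :
    (E.page r ((two_le a).trans hr)).d b a = 0
  d_from (a b : ℤ × ℤ) (r : ℤ) (hr : N a ≤ r) :
    (E.page r ((two_le a).trans hr)).d a b = 0
  /-- the limit terms `E^∞` -/
  Einf : ℤ × ℤ → A
  /-- the identification of `Eʳ_{p,q}`, for large `r`, with `E^∞_{p,q}` -/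
  isoInf (a : ℤ × ℤ) (r : ℤ) (hr : N a ≤ r) :
    (E.page r ((two_le a).trans hr)).X a ≅ Einf a
  isoInf_comm (a : ℤ × ℤ) (r : ℤ) (hr : N a ≤ r) :
    (E.page r ((two_le a).trans hr)).iCycles a ≫ (isoInf a r hr).hom =
      (E.page r ((two_le a).trans hr)).homologyπ a ≫
        (E.iso r (r + 1) a rfl ((two_le a).trans hr)).hom ≫
          (isoInf a (r + 1) (hr.trans (Int.le_add_one le_rfl))).hom
  /-- the filtration `F n p = F_p H_n` -/
  F (n p : ℤ) : Subobject (H n)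
  F_le (n p : ℤ) : F n (p - 1) ≤ F n p
  F_eq_bot (n : ℤ) : ∃ p, F n p = ⊥
  F_eq_top (n : ℤ) : ∃ p, F n p = ⊤
  /-- the identification of the graded pieces -/
  gr (n p q : ℤ) (h : p + q = n) :
    cokernel (Subobject.ofLE (F n (p - 1)) (F n p) (F_le n p)) ≅ Einf (p, q)

/-- If `a = (p, q)` is stationary from the second page on, this is the canonical map
`F_p H_n ⟶ F_p H_n / F_{p-1} H_n ≅ E^∞_{p,q} ≅ E²_{p,q}` for `p + q = n`. -/
def Convergence.toE₂ {A : Type u} [Category.{v} A] [Abelian A]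
    {E : HomologicalSpectralSequence A} {H : ℤ → A} (c : Convergence E H) (n p q : ℤ)
    (h : p + q = n) (hN : c.N (p, q) ≤ 2) :
    (c.F n p : A) ⟶ (E.page 2 le_rfl).X (p, q) :=
  cokernel.π _ ≫ (c.gr n p q h).hom ≫ (c.isoInf (p, q) 2 hN).inv

end

end Kunneth

/-! Everything rests on one fact: an abelian sheaf is flat exactly when it is torsion-free. Over ℤ,
tensoring with a torsion-free group preserves injections, and sheafification is exact. Conversely,
tensoring multiplication by `n` on the constant sheaf ℤ with `P` gives multiplication by `n` on `P`.
Hence subsheaves of flat sheaves are flat. As every sheaf is a quotient of a sheafified free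
presheaf, the Tor-dimension is at most one.

Let `P` be an unbounded complex of flat objects, `Z` its cycles and `B = P/Z`, so that `Bʲ` embeds
in `Zʲ⁺¹` as the boundaries. Both are flat with zero differential. Tensoring any `X` with `0 → Z → P
→ B → 0` stays exact (`shortExact_totCycles`), and `Hⁿ(X ⊗ Z)` and `Hⁿ(X ⊗ B)` are the sums of
`Hⁱ(X) ⊗ Zʲ` and `Hⁱ(X) ⊗ Bʲ` (`isIso_desc_cross`). In the long exact sequence the connecting map
is, up to sign, `Hⁱ(X)` tensored with `Bʲ → Zʲ⁺¹` (`cross_δ`). Since `0 → Bʲ → Zʲ⁺¹ → Hʲ⁺¹(P) → 0`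
is a flat presentation, its cokernel is the tensor part and its kernel the `Tor₁` part. Cutting the
sequence at `Hⁿ(X ⊗ P)` gives the Künneth sequence (`exists_kunneth_shortExact`). Only flatness of
the terms of `P` is used, so every choice of flat resolutions is allowed.

This part is written for a right exact bifunctor with a class of flat objects. There `tor₁` comes
from a cover of the first variable, and the snake lemma shows that the second variable gives the
same object (`nonempty_kernel_iso_tor₁`). Künneth for complexes concentrated in degree `0` then
identifies `Tor_r`.

The spectral sequence is built backwards from the Künneth sequences: `E²` lives in the columns `0`
and `1`, all differentials are set to zero, and the image of the tensor part serves as `F₀`. -/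

namespace Kunneth

noncomputable section

section

variable {C : Type u} [Category.{v} C] (J : GrothendieckTopology C)

/-! ### Compatibility of the tensor product of presheaves with sheafification -/

-- Modules form a closed monoidal category, and the internal hom from a presheaf to a sheaf is again
-- a sheaf, so the morphisms inverted by sheafification are stable under tensoring. The instances
-- inside provide the ends that define these internal homs.
open MonoidalClosed Enriched.FunctorCategory MonoidalCategory in
lemma W_whiskerRight_moduleCat {F G : Cᵒᵖ ⥤ ModuleCat.{max u v} (ULift.{max u v} ℤ)} {f : F ⟶ G}
    (hf : J.W f) (P : Cᵒᵖ ⥤ ModuleCat.{max u v} (ULift.{max u v} ℤ)) : J.W (f ▷ P) := by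
  have : HasLimitsOfSize.{u, max u v} (ModuleCat.{max u v} (ULift.{max u v} ℤ)) :=
    hasLimitsOfSizeShrink.{u, max u v, max u v, max u v} _
  have : HasLimitsOfSize.{v, max u v} (ModuleCat.{max u v} (ULift.{max u v} ℤ)) :=
    hasLimitsOfSizeShrink.{v, max u v, max u v, max u v} _
  have (F₁ F₂ : Cᵒᵖ ⥤ ModuleCat.{max u v} (ULift.{max u v} ℤ)) :
      HasEnrichedHom (ModuleCat.{max u v} (ULift.{max u v} ℤ)) F₁ F₂ := by
    unfold HasEnrichedHom HasEnd
    infer_instance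
  have (F₁ F₂ : Cᵒᵖ ⥤ ModuleCat.{max u v} (ULift.{max u v} ℤ)) :
      HasFunctorEnrichedHom (ModuleCat.{max u v} (ULift.{max u v} ℤ)) F₁ F₂ := by
    intro X
    unfold HasEnrichedHom HasEnd
    infer_instance
  exact GrothendieckTopology.W.whiskerRight hf P

/-- A homomorphism of abelian groups is linear over a lift of `ℤ` to a higher universe. -/
def toULiftLinearMap {A B : AddCommGrpCat.{w}} (f : A ⟶ B) : A →ₗ[ULift.{w} ℤ] B :=
  { f.hom with map_smul' := fun n a => map_zsmul f.hom n.down a }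

/-- An abelian group, as a module over a lift of `ℤ` to a higher universe. -/
def toULiftModule : AddCommGrpCat.{w} ⥤ ModuleCat.{w} (ULift.{w} ℤ) where
  obj A := ModuleCat.of (ULift.{w} ℤ) A
  map f := ModuleCat.ofHom (toULiftLinearMap f)

/-- The tensor products over `ℤ` and over a lift of `ℤ` agree. -/
def tensorULiftEquiv (A B : AddCommGrpCat.{w}) :
    TensorProduct (ULift.{w} ℤ) A B ≃+ TensorProduct ℤ A B :=
  (TensorProduct.equivOfCompatibleSMul ℤ (ULift.{w} ℤ) ℤ A B).toAddEquiv

lemma tensorULiftEquiv_map {A A' B B' : AddCommGrpCat.{w}} (f : A ⟶ A') (g : B ⟶ B')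
    (x : TensorProduct (ULift.{w} ℤ) A B) :
    tensorULiftEquiv A' B'
      (TensorProduct.map (toULiftLinearMap f) (toULiftLinearMap g) x) =
      (tensorAbMap f g).hom (tensorULiftEquiv A B x) := by
  induction x using TensorProduct.induction_on with
  | zero => simp only [map_zero]
  | tmul a b => rfl
  | add x y hx hy => simp only [map_add, hx, hy]

open MonoidalCategory in
/-- Tensoring with a presheaf preserves the morphisms inverted by sheafification. -/
lemma W_tensorPsh_map_app {F G : Cᵒᵖ ⥤ AddCommGrpCat.{max u v}} {f : F ⟶ G} (hf : J.W f)
    (P : Cᵒᵖ ⥤ AddCommGrpCat.{max u v}) : J.W (((tensorPsh C).map f).app P) := by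
  -- Being inverted by sheafification means being locally bijective, a condition on underlying maps
  -- of sets. It can therefore be carried between abelian groups and modules over the lifted ring.
  have hf' : J.W (Functor.whiskerRight f toULiftModule.{max u v}) := by
    rw [GrothendieckTopology.W_iff_isLocallyBijective] at hf ⊢
    exact ⟨⟨fun x y h => hf.1.equalizerSieve_mem x y h⟩, ⟨fun s => hf.2.imageSieve_mem s⟩⟩
  have h := W_whiskerRight_moduleCat J hf' (P ⋙ toULiftModule.{max u v})
  rw [GrothendieckTopology.W_iff_isLocallyBijective] at h ⊢
  have e (X : Cᵒᵖ) (z : TensorProduct (ULift.{max u v} ℤ) (F.obj X) (P.obj X)) :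
      tensorULiftEquiv _ _ (((Functor.whiskerRight f toULiftModule.{max u v} ▷
        (P ⋙ toULiftModule.{max u v})).app X).hom z) =
      ((((tensorPsh C).map f).app P).app X).hom (tensorULiftEquiv _ _ z) :=
    tensorULiftEquiv_map (f.app X) (𝟙 (P.obj X)) z
  constructor
  · refine ⟨fun {X} x y hxy => ?_⟩
    obtain ⟨x', rfl⟩ := (tensorULiftEquiv _ _).surjective x
    obtain ⟨y', rfl⟩ := (tensorULiftEquiv _ _).surjective y
    refine J.superset_covering ?_ (h.1.equalizerSieve_mem (X := X) x' y' ?_)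
    · intro V i hi
      exact ((tensorULiftEquiv_map (F.map i.op) (P.map i.op) x').symm.trans
        (congrArg (tensorULiftEquiv _ _) hi)).trans
        (tensorULiftEquiv_map (F.map i.op) (P.map i.op) y')
    · exact (tensorULiftEquiv _ _).injective ((e X x').trans (hxy.trans (e X y').symm))
  · refine ⟨fun {X} s => ?_⟩
    obtain ⟨s', rfl⟩ := (tensorULiftEquiv _ _).surjective s
    refine J.superset_covering ?_ (h.2.imageSieve_mem (U := X) s')
    rintro V i ⟨t, ht⟩
    exact ⟨tensorULiftEquiv _ _ t, (e _ t).symm.trans ((congrArg (tensorULiftEquiv _ _) ht).trans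
      (tensorULiftEquiv_map (G.map i.op) (P.map i.op) s'))⟩

end

section

/-! ### Right exactness of the tensor product -/

/-- In a reflective subcategory, a colimit of `F` is the reflection of the colimit of `F ⋙ R`,
because the counit is invertible. So preservation may be tested after composing with `L`. -/
lemma reflective_preservesColimitsOfShape {D E X : Type*} [Category* D] [Category* E] [Category* X]
    {L : D ⥤ E} {R : E ⥤ D} (adj : L ⊣ R) [R.Full] [R.Faithful] (G : E ⥤ X)
    (K : Type*) [Category* K] [HasColimitsOfShape K D] [PreservesColimitsOfShape K (L ⋙ G)] :
    PreservesColimitsOfShape K G where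
  preservesColimit {F} := by
    have := adj.isLeftAdjoint
    have : PreservesColimitsOfShape K L := adj.leftAdjoint_preservesColimits.preservesColimitsOfShape
    have : PreservesColimit ((F ⋙ R) ⋙ L) G :=
      preservesColimit_of_preserves_colimit_cocone
        (isColimitOfPreserves L (colimit.isColimit (F ⋙ R)))
        (isColimitOfPreserves (L ⋙ G) (colimit.isColimit (F ⋙ R)))
    exact preservesColimit_of_iso_diagram G
      (Functor.associator F R L ≪≫ Functor.isoWhiskerLeft F (asIso adj.counit) ≪≫ F.rightUnitor)

/-- The functor `- ⊗ B` on abelian groups. -/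
def tensorAbRight (B : AddCommGrpCat.{w}) : AddCommGrpCat.{w} ⥤ AddCommGrpCat.{w} where
  obj A := tensorAb A B
  map f := tensorAbMap f (𝟙 B)
  map_id A := tensorAbMap_id A B
  map_comp f g := by rw [← tensorAbMap_comp, Category.id_comp]

instance (B : AddCommGrpCat.{w}) : (tensorAbRight B).Additive where
  map_add := tensorAbMap_add_left _ _ _

instance (B : AddCommGrpCat.{w}) : PreservesFiniteColimits (tensorAbRight B) := by
  apply ((tensorAbRight B).preservesFiniteColimits_tfae.out 0 3).1
  intro S hS
  have hg : Function.Surjective S.g.hom := (AddCommGrpCat.epi_iff_surjective _).1 hS.epi_g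
  constructor
  · rw [ShortComplex.ab_exact_iff_function_exact]
    exact rTensor_exact (f := S.f.hom.toIntLinearMap) (g := S.g.hom.toIntLinearMap) B
      ((ShortComplex.ab_exact_iff_function_exact S).1 hS.exact) hg
  · rw [AddCommGrpCat.epi_iff_surjective]
    exact LinearMap.rTensor_surjective B (g := S.g.hom.toIntLinearMap) hg

instance {C : Type u} [Category.{v} C] (P : Cᵒᵖ ⥤ AddCommGrpCat.{w}) :
    PreservesFiniteColimits ((tensorPsh C).flip.obj P) :=
  preservesFiniteColimits_of_evaluation _ fun U =>
    inferInstanceAs (PreservesFiniteColimits ((evaluation _ _).obj U ⋙ tensorAbRight (P.obj U)))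

variable {C : Type u} [Category.{v} C] {J : GrothendieckTopology C}

/-- Sheafification is compatible with tensor products. -/
def presheafToSheafTensorIso (P : AbSheaf J) :
    (tensorPsh C).flip.obj P.obj ⋙ presheafToSheaf J _ ≅
      presheafToSheaf J _ ⋙ (tensorSh J).flip.obj P :=
  NatIso.ofComponents (fun F => @asIso _ _ _ _ ((presheafToSheaf J _).map
      (((tensorPsh C).map (toSheafify J F)).app P.obj))
      ((J.W_iff _).1 (W_tensorPsh_map_app J (J.W_toSheafify F) P.obj))) fun {F G} f => by
    change (presheafToSheaf J _).map (((tensorPsh C).map f).app P.obj) ≫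
      (presheafToSheaf J _).map (((tensorPsh C).map (toSheafify J G)).app P.obj) =
      (presheafToSheaf J _).map (((tensorPsh C).map (toSheafify J F)).app P.obj) ≫
      (presheafToSheaf J _).map (((tensorPsh C).map (sheafifyMap J f)).app P.obj)
    rw [← Functor.map_comp, ← Functor.map_comp, ← NatTrans.comp_app, ← NatTrans.comp_app,
      ← Functor.map_comp, ← Functor.map_comp, toSheafify_naturality]

/-- After precomposition with sheafification this functor is the presheaf tensor product followed by
sheafification, and both preserve finite colimits. -/
instance (P : AbSheaf J) : PreservesFiniteColimits ((tensorSh J).flip.obj P) where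
  preservesFiniteColimits K _ _ := by
    have : PreservesColimitsOfShape K (presheafToSheaf J AddCommGrpCat.{max u v}) :=
      (sheafificationAdjunction J _).leftAdjoint_preservesColimits.preservesColimitsOfShape
    have : PreservesColimitsOfShape K (presheafToSheaf J _ ⋙ (tensorSh J).flip.obj P) :=
      preservesColimitsOfShape_of_natIso (presheafToSheafTensorIso P)
    exact reflective_preservesColimitsOfShape
      (sheafificationAdjunction J AddCommGrpCat.{max u v}) ((tensorSh J).flip.obj P) K

/-! ### Symmetry -/

instance {A : Type*} [Category* A] [Preadditive A] (T : A ⥤ A ⥤ A) [T.Additive] (P : A) :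
    (T.flip.obj P).Additive where
  map_add {_ _ f g} := congrArg (fun t => NatTrans.app t P) (T.map_add (f := f) (g := g))

/-- The symmetry of the tensor product of abelian groups. -/
def tensorAbComm (A B : AddCommGrpCat.{w}) : tensorAb A B ≅ tensorAb B A :=
  (TensorProduct.comm ℤ A B).toAddEquiv.toAddCommGrpIso

lemma tensorAbComm_naturality {A A' B B' : AddCommGrpCat.{w}} (f : A ⟶ A') (g : B ⟶ B') :
    tensorAbMap f g ≫ (tensorAbComm A' B').hom = (tensorAbComm A B).hom ≫ tensorAbMap g f :=
  tensorAb_hom_ext fun _ _ => rfl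

/-- The symmetry of the tensor product of presheaves. -/
def tensorPshComm (F G : Cᵒᵖ ⥤ AddCommGrpCat.{w}) :
    ((tensorPsh C).obj F).obj G ≅ ((tensorPsh C).obj G).obj F :=
  NatIso.ofComponents (fun U => tensorAbComm (F.obj U) (G.obj U))
    fun i => tensorAbComm_naturality (F.map i) (G.map i)

/-- The symmetry of the tensor product of sheaves. -/
def tensorShComm (P : AbSheaf J) : (tensorSh J).flip.obj P ≅ (tensorSh J).obj P :=
  NatIso.ofComponents (fun F => (presheafToSheaf J _).mapIso (tensorPshComm F.obj P.obj))
    fun {F G} f => by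
      change (presheafToSheaf J _).map _ ≫ (presheafToSheaf J _).map _ =
        (presheafToSheaf J _).map _ ≫ (presheafToSheaf J _).map _
      rw [← Functor.map_comp, ← Functor.map_comp]
      congr 1
      ext U : 2
      exact tensorAbComm_naturality (f.hom.app U) (𝟙 (P.obj.obj U))

instance (P : AbSheaf J) : PreservesFiniteColimits ((tensorSh J).obj P) :=
  preservesFiniteColimits_of_natIso (tensorShComm P)

/-! ### Flat sheaves are the torsion-free sheaves -/

/-- An object of a preadditive category is torsion-free if the multiplication by every nonzero
integer is a monomorphism. -/
def TorsionFree {A : Type*} [Category* A] [Preadditive A] (P : A) : Prop :=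
  ∀ n : ℤ, n ≠ 0 → Mono (n • 𝟙 P)

/-- Multiplication by `n` commutes with every morphism. This closure under subobjects is the source
of the bound on the Tor-dimension. -/
lemma TorsionFree.of_mono {A : Type*} [Category* A] [Preadditive A] {P Q : A}
    (hP : TorsionFree P) (f : Q ⟶ P) [Mono f] : TorsionFree Q := fun n hn => by
  have := hP n hn
  have : Mono ((n • 𝟙 Q) ≫ f) := by
    rw [show (n • 𝟙 Q) ≫ f = f ≫ (n • 𝟙 P) by simp]
    infer_instance
  exact mono_of_mono _ f

lemma TorsionFree.map {A B : Type*} [Category* A] [Preadditive A] [Category* B] [Preadditive B]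
    (F : A ⥤ B) [F.Additive] [F.PreservesMonomorphisms] {P : A} (hP : TorsionFree P) :
    TorsionFree (F.obj P) := fun n hn => by
  have := hP n hn
  rw [← F.map_id, ← F.map_zsmul]
  infer_instance

lemma torsionFree_iff_isTorsionFree (A : AddCommGrpCat.{w}) :
    TorsionFree A ↔ Module.IsTorsionFree ℤ A := by
  have h (n : ℤ) : Mono (n • 𝟙 A) ↔ IsSMulRegular A n := by
    rw [AddCommGrpCat.mono_iff_injective]
    rfl
  simp only [TorsionFree, h]
  exact ⟨fun H => ⟨fun n hn => H n hn.ne_zero⟩, fun H n hn => H.isSMulRegular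
    (IsRegular.of_ne_zero hn)⟩

lemma mono_tensorAbMap {A A' B : AddCommGrpCat.{w}} (f : A ⟶ A') [Mono f] (hB : TorsionFree B) :
    Mono (tensorAbMap f (𝟙 B)) := by
  have := (torsionFree_iff_isTorsionFree B).1 hB
  rw [AddCommGrpCat.mono_iff_injective]
  exact Module.Flat.rTensor_preserves_injective_linearMap (M := B) f.hom.toIntLinearMap
    ((AddCommGrpCat.mono_iff_injective f).1 inferInstance)

lemma TorsionFree.app {P : Cᵒᵖ ⥤ AddCommGrpCat.{w}} (hP : TorsionFree P) (U : Cᵒᵖ) :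
    TorsionFree (P.obj U) :=
  hP.map ((evaluation _ _).obj U)

lemma TorsionFree.of_app {P : Cᵒᵖ ⥤ AddCommGrpCat.{w}} (hP : ∀ U, TorsionFree (P.obj U)) :
    TorsionFree P := fun n hn => by
  rw [NatTrans.mono_iff_mono_app]
  exact fun U => hP U n hn

instance : (sheafToPresheaf J AddCommGrpCat.{max u v}).PreservesMonomorphisms :=
  (sheafToPresheaf J AddCommGrpCat.{max u v}).preservesMonomorphisms_of_adjunction
    (sheafificationAdjunction J _)

/-- A monomorphism of sheaves is injective on sections, tensoring with the torsion-free groups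
`P(U)` keeps it injective, and sheafification preserves monomorphisms. -/
lemma TorsionFree.preservesMonomorphisms_flip {P : AbSheaf J} (hP : TorsionFree P) :
    ((tensorSh J).flip.obj P).PreservesMonomorphisms where
  preserves {F G} f _ := by
    have hP' : TorsionFree P.obj := hP.map (sheafToPresheaf J _)
    have hf : Mono ((sheafToPresheaf J _).map f) := inferInstance
    rw [NatTrans.mono_iff_mono_app] at hf
    have : Mono (((tensorPsh C).map ((sheafToPresheaf J _).map f)).app P.obj) := by
      rw [NatTrans.mono_iff_mono_app]
      exact fun U => have := hf U; mono_tensorAbMap _ (hP'.app U)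
    exact inferInstanceAs (Mono ((presheafToSheaf J _).map
      (((tensorPsh C).map ((sheafToPresheaf J _).map f)).app P.obj)))

lemma TorsionFree.preservesMonomorphisms {P : AbSheaf J} (hP : TorsionFree P) :
    ((tensorSh J).obj P).PreservesMonomorphisms :=
  have := hP.preservesMonomorphisms_flip
  Functor.PreservesMonomorphisms.of_iso (tensorShComm P)

lemma TorsionFree.isFlat {P : AbSheaf J} (hP : TorsionFree P) : IsFlat P := fun S hS => by
  have := hP.preservesMonomorphisms_flip
  have := hS.mono_f
  have := hS.epi_g
  exact
    { exact := hS.exact.map_of_epi_of_preservesCokernel ((tensorSh J).flip.obj P) hS.epi_g inferInstance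
      mono_f := inferInstanceAs (Mono (((tensorSh J).flip.obj P).map S.f))
      epi_g := inferInstanceAs (Epi (((tensorSh J).flip.obj P).map S.g)) }

/-- The constant presheaf `ℤ` is a unit for the tensor product. -/
def constTensorIso (F : Cᵒᵖ ⥤ AddCommGrpCat.{w}) :
    ((tensorPsh C).obj ((Functor.const _).obj (AddCommGrpCat.of (ULift.{w} ℤ)))).obj F ≅ F :=
  NatIso.ofComponents (fun U => AddEquiv.toAddCommGrpIso
    (X := tensorAb (AddCommGrpCat.of (ULift.{w} ℤ)) (F.obj U)) (Y := F.obj U)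
    ((TensorProduct.congr (ULift.moduleEquiv (R := ℤ)) (LinearEquiv.refl ℤ (F.obj U))).trans
      (TensorProduct.lid ℤ (F.obj U))).toAddEquiv) fun i =>
    tensorAb_hom_ext fun _ _ => (map_zsmul (F.map i).hom _ _).symm

lemma torsionFree_uliftInt : TorsionFree (AddCommGrpCat.of (ULift.{w} ℤ)) := by
  rw [torsionFree_iff_isTorsionFree]
  exact (ULift.moduleEquiv (R := ℤ) (M := ℤ)).injective.moduleIsTorsionFree _ (map_smul _)

/-- Flatness is tested on multiplication by `n` on the constant sheaf ℤ, the tensor unit. This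
direction is what admits arbitrary flat resolutions, whose terms are only known to be flat. -/
lemma IsFlat.torsionFree {P : AbSheaf J} (hP : IsFlat P) : TorsionFree P := fun n hn => by
  let Z : Cᵒᵖ ⥤ AddCommGrpCat.{max u v} :=
    (Functor.const _).obj (AddCommGrpCat.of (ULift.{max u v} ℤ))
  have hZ : TorsionFree ((presheafToSheaf J _).obj Z) :=
    (TorsionFree.of_app fun _ => torsionFree_uliftInt).map _
  have := hZ n hn
  let S := ShortComplex.mk (n • 𝟙 ((presheafToSheaf J _).obj Z)) (cokernel.π _)
    (cokernel.condition _)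
  have hS : S.ShortExact := { exact := ShortComplex.exact_cokernel _ }
  have h : Mono (((tensorSh J).flip.obj P).map (n • 𝟙 ((presheafToSheaf J _).obj Z))) :=
    (hP S hS).mono_f
  let e : ((tensorSh J).flip.obj P).obj ((presheafToSheaf J _).obj Z) ≅ P :=
    ((presheafToSheafTensorIso P).app Z).symm ≪≫ (presheafToSheaf J _).mapIso
      (constTensorIso P.obj) ≪≫ asIso ((sheafificationAdjunction J _).counit.app P)
  have : n • 𝟙 P = e.inv ≫ (((tensorSh J).flip.obj P).map
      (n • 𝟙 ((presheafToSheaf J _).obj Z))) ≫ e.hom := by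
    rw [Functor.map_zsmul, CategoryTheory.Functor.map_id]
    simp
  rw [this]
  infer_instance

end

section

/-! ### Flat resolutions -/

lemma TorsionFree.biprod {A : Type*} [Category* A] [Abelian A] {P Q : A}
    (hP : TorsionFree P) (hQ : TorsionFree Q) : TorsionFree (P ⊞ Q) := fun n hn => by
  have := hP n hn
  have := hQ n hn
  rw [show n • 𝟙 (P ⊞ Q) = biprod.map (n • 𝟙 P) (n • 𝟙 Q) by ext <;> simp]
  infer_instance

lemma TorsionFree.of_iso {A : Type*} [Category* A] [Preadditive A] {P Q : A}
    (hP : TorsionFree P) (e : Q ≅ P) : TorsionFree Q := hP.of_mono e.hom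

open CochainComplex in
lemma TorsionFree.mappingCone {A : Type*} [Category* A] [Abelian A] {K L : CochainComplex A ℤ}
    (φ : K ⟶ L) (hK : ∀ i, TorsionFree (K.X i)) (hL : ∀ i, TorsionFree (L.X i)) (i : ℤ) :
    TorsionFree ((mappingCone φ).X i) :=
  ((hK (i + 1)).biprod (hL i)).of_iso
    (HomologicalComplex.homotopyCofiber.XIsoBiprod φ i (i + 1) rfl)

section

variable {A : Type*} [Category* A] [Abelian A] (Y : CochainComplex A ℤ) {Q : ℤ → A}
  (q : ∀ i, Q i ⟶ Y.X i)

open CochainComplex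

/-- The complex with zero differentials and the terms `Q i`, shifted by one. -/
def zeroComplex (Q : ℤ → A) : CochainComplex A ℤ where
  -- With this shift the cone of the identity has `Q (i + 1 - 1) ⊞ Q (i - 1)` in degree `i`; the
  -- first summand is the one that covers `Y.X i`.
  X i := Q (i - 1)
  d _ _ := 0

/-- The family `q`, as a cochain. -/
def coverCochain : HomComplex.Cochain (zeroComplex Q) Y (-1) :=
  HomComplex.Cochain.mk fun i j h => q (i - 1) ≫ (Y.XIsoOfEq (show i - 1 = j by lia)).hom

/-- The morphism from a sum of disks to a complex determined by morphisms to its terms. -/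
def coverMap : mappingCone (𝟙 (zeroComplex Q)) ⟶ Y :=
  mappingCone.desc (𝟙 (zeroComplex Q)) (coverCochain Y q)
    (HomComplex.Cocycle.homOf (HomComplex.Cocycle.mk (HomComplex.δ (-1) 0 (coverCochain Y q)) 1 rfl
      (HomComplex.δ_δ _ _ _ _))) (by simp)

/-- Already the restriction to the first summand of the cone is `q i`, up to identification of
indices. -/
lemma epi_coverMap_f [hq : ∀ i, Epi (q i)] (i : ℤ) : Epi ((coverMap Y q).f i) := by
  have h : (mappingCone.inl (𝟙 (zeroComplex Q))).v (i + 1) i (by lia) ≫ (coverMap Y q).f i =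
      q (i + 1 - 1) ≫ (Y.XIsoOfEq (show i + 1 - 1 = i by lia)).hom :=
    mappingCone.inl_v_desc_f _ _ _ _ _ _ _
  have : Epi ((mappingCone.inl (𝟙 (zeroComplex Q))).v (i + 1) i (by lia) ≫
      (coverMap Y q).f i) := by
    rw [h]
    exact @epi_comp _ _ _ _ _ _ (hq _) _ inferInstance
  exact epi_of_epi ((mappingCone.inl (𝟙 (zeroComplex Q))).v (i + 1) i _) _

end

variable {C : Type u} [Category.{v} C] {J : GrothendieckTopology C}

lemma torsionFree_free (X : Type w) : TorsionFree (AddCommGrpCat.free.obj X) := by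
  rw [torsionFree_iff_isTorsionFree]
  exact inferInstanceAs (Module.IsTorsionFree ℤ (FreeAbelianGroup X))

/-- The free abelian groups on the sets of sections form a torsion-free presheaf surjecting onto
`G`; sheafification keeps both properties. -/
lemma exists_torsionFree_epi (G : AbSheaf J) :
    ∃ (P : AbSheaf J) (p : P ⟶ G), TorsionFree P ∧ Epi p := by
  let F : Cᵒᵖ ⥤ AddCommGrpCat.{max u v} := G.obj ⋙ forget _ ⋙ AddCommGrpCat.free
  let f : F ⟶ G.obj := Functor.whiskerLeft G.obj AddCommGrpCat.adj.counit
  have : Epi f := by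
    rw [NatTrans.epi_iff_epi_app]
    intro U
    rw [AddCommGrpCat.epi_iff_surjective]
    intro x
    exact ⟨FreeAbelianGroup.of x, FreeAbelianGroup.lift_apply_of id x⟩
  have : Epi ((presheafToSheaf J _).map f) := inferInstance
  exact ⟨(presheafToSheaf J _).obj F, (presheafToSheaf J _).map f ≫
    (sheafificationAdjunction J _).counit.app G,
    (TorsionFree.of_app fun U => torsionFree_free _).map _, epi_comp _ _⟩

/-- A sum `F` of disks on torsion-free sheaves maps onto `Y` degreewise, and the kernel is
torsion-free as a subobject. The cone of kernel `→ F` resolves `Y`; a single step suffices, so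
boundedness plays no role. -/
lemma exists_flatResolution (Y : CochainComplex (AbSheaf J) ℤ) : Nonempty (FlatResolution Y) := by
  choose Q q hQ hq using fun i => exists_torsionFree_epi (Y.X i)
  let F := CochainComplex.mappingCone (𝟙 (zeroComplex Q))
  have hF (i : ℤ) : TorsionFree (F.X i) :=
    TorsionFree.mappingCone _ (fun i => hQ (i - 1)) (fun i => hQ (i - 1)) i
  let S := ShortComplex.mk (kernel.ι (coverMap Y q)) (coverMap Y q) (kernel.condition _)
  have : Epi (coverMap Y q) := by
    have := epi_coverMap_f Y q
    exact HomologicalComplex.epi_of_epi_f _ inferInstance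
  have hS : S.ShortExact := { exact := ShortComplex.exact_kernel _ }
  refine ⟨⟨CochainComplex.mappingCone S.f, CochainComplex.mappingCone.descShortComplex S,
    fun i => (TorsionFree.mappingCone _ (fun j => (hF j).of_mono (S.f.f j)) hF i).isFlat,
    CochainComplex.mappingCone.quasiIso_descShortComplex hS⟩⟩

lemma exists_flat_presentation (G : AbSheaf J) : ∃ S : ShortComplex (AbSheaf J), S.ShortExact ∧
    TorsionFree S.X₁ ∧ TorsionFree S.X₂ ∧ S.X₃ = G := by
  obtain ⟨P, p, hP, _⟩ := exists_torsionFree_epi G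
  exact ⟨ShortComplex.mk (kernel.ι p) p (kernel.condition p),
    { exact := ShortComplex.exact_kernel _ }, hP.of_mono (kernel.ι p), hP, rfl⟩

/-- Exactness of filtered colimits gives exactness of coproducts. Universe `0` is enough, since the
coproducts run over pairs of integers. -/
instance : AB4OfSize.{0} (AbSheaf J) := by
  have : HasColimitsOfSize.{max u v, max u v} (AbSheaf J) := Sheaf.instHasColimitsOfSize
  have : HasFiniteBiproducts (AbSheaf J) := Abelian.hasFiniteBiproducts
  have : AB5OfSize.{max u v, max u v} (AbSheaf J) := Sheaf.ab5ofSize J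
  have : AB4OfSize.{max u v} (AbSheaf J) := AB4.of_AB5 _
  exact AB4OfSize_shrink.{0, max u v} _

end

/-! ### Flat objects for a right exact bifunctor, and the first derived functor -/

section

set_option linter.unusedSectionVars false

variable {A : Type u} [Category.{v} A] [Abelian A]

/-- A class of flat objects for a bifunctor `T`: it is closed under subobjects, and every object
is a quotient of a flat object. -/
structure FlatClass (T : A ⥤ A ⥤ A) (flat : A → Prop) : Prop where
  left {P : A} : flat P → (T.flip.obj P).PreservesMonomorphisms
  right {P : A} : flat P → (T.obj P).PreservesMonomorphisms
  of_mono {P Q : A} (hP : flat P) (f : Q ⟶ P) [Mono f] : flat Q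
  exists_epi (X : A) : ∃ (P : A) (p : P ⟶ X), flat P ∧ Epi p

namespace FlatClass

variable {T : A ⥤ A ⥤ A} {flat : A → Prop} (h : FlatClass T flat)

/-- A flat object covering `X`. -/
def cover (X : A) : A := (h.exists_epi X).choose

/-- The projection from a flat cover. -/
def coverπ (X : A) : h.cover X ⟶ X := (h.exists_epi X).choose_spec.choose

lemma flat_cover (X : A) : flat (h.cover X) := (h.exists_epi X).choose_spec.choose_spec.1

instance (X : A) : Epi (h.coverπ X) := (h.exists_epi X).choose_spec.choose_spec.2

/-- The first derived functor of `T`, computed with a flat presentation of the first variable. -/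
def tor₁ (X Y : A) : A := kernel ((T.map (kernel.ι (h.coverπ X))).app Y)

end FlatClass

variable {T : A ⥤ A ⥤ A} [T.Additive] [∀ X, (T.obj X).Additive]
  [∀ X, PreservesFiniteColimits (T.obj X)] [∀ X, PreservesFiniteColimits (T.flip.obj X)]
  {flat : A → Prop} (h : FlatClass T flat)

/-- The snake diagram comparing flat presentations of the two variables. -/
def torSnake (X : A) (S : ShortComplex A) (hS : S.ShortExact) : ShortComplex.SnakeInput A where
  L₀ := kernel (S.mapNatTrans (T.map (kernel.ι (h.coverπ X))))
  L₁ := S.map (T.obj (kernel (h.coverπ X)))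
  L₂ := S.map (T.obj (h.cover X))
  L₃ := cokernel (S.mapNatTrans (T.map (kernel.ι (h.coverπ X))))
  v₀₁ := kernel.ι _
  v₁₂ := S.mapNatTrans (T.map (kernel.ι (h.coverπ X)))
  v₂₃ := cokernel.π _
  w₀₂ := kernel.condition _
  w₁₃ := cokernel.condition _
  h₀ := kernelIsKernel _
  h₃ := cokernelIsCokernel _
  L₁_exact := have := hS.epi_g; hS.exact.map_of_epi_of_preservesCokernel _ hS.epi_g inferInstance
  epi_L₁_g := have := hS.epi_g; inferInstanceAs (Epi ((T.obj _).map S.g))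
  L₂_exact := have := hS.epi_g; hS.exact.map_of_epi_of_preservesCokernel _ hS.epi_g inferInstance
  mono_L₂_f := by
    have := hS.mono_f
    have := h.right (h.flat_cover X)
    exact inferInstanceAs (Mono ((T.obj _).map S.f))

/-- `T(X, Y)` as a cokernel. -/
def isColimitCover (X Y : A) : IsColimit (CokernelCofork.ofπ
    (f := (T.map (kernel.ι (h.coverπ X))).app Y) ((T.map (h.coverπ X)).app Y)
    (by rw [← NatTrans.comp_app, ← T.map_comp, kernel.condition, T.map_zero]; rfl)) :=
  CokernelCofork.mapIsColimit (CokernelCofork.ofπ (h.coverπ X) (kernel.condition _))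
    (Abelian.epiIsCokernelOfKernel (KernelFork.ofι _ (kernel.condition _)) (kernelIsKernel _))
    (T.flip.obj Y)

-- Balancing of the derived functor. Flatness of `S.X₂` makes the middle column of the snake diagram
-- a monomorphism, so the snake map embeds `tor₁(X, S.X₃)` into the row of cokernels, which is `T(X,
-- S.X₁) → T(X, S.X₂)`, as the kernel of that map.
include h in
lemma nonempty_kernel_iso_tor₁ (X : A) {S : ShortComplex A} (hS : S.ShortExact)
    (hS₂ : flat S.X₂) : Nonempty (kernel ((T.obj X).map S.f) ≅ h.tor₁ X S.X₃) := by
  let D := torSnake h X S hS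
  let e₁ : D.L₃.X₁ ≅ (T.obj X).obj S.X₁ :=
    D.h₃τ₁.coconePointUniqueUpToIso (isColimitCover h X S.X₁)
  let e₂ : D.L₃.X₂ ≅ (T.obj X).obj S.X₂ :=
    D.h₃τ₂.coconePointUniqueUpToIso (isColimitCover h X S.X₂)
  have he₁ : D.v₂₃.τ₁ ≫ e₁.hom = (T.map (h.coverπ X)).app S.X₁ :=
    D.h₃τ₁.comp_coconePointUniqueUpToIso_hom (isColimitCover h X S.X₁) .one
  have he₂ : D.v₂₃.τ₂ ≫ e₂.hom = (T.map (h.coverπ X)).app S.X₂ :=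
    D.h₃τ₂.comp_coconePointUniqueUpToIso_hom (isColimitCover h X S.X₂) .one
  have : Epi D.v₂₃.τ₁ := epi_of_isColimit_cofork D.h₃τ₁
  have comm : D.L₃.f ≫ e₂.hom = e₁.hom ≫ (T.obj X).map S.f := by
    rw [← cancel_epi D.v₂₃.τ₁, D.v₂₃.comm₁₂_assoc, he₂, reassoc_of% he₁]
    exact (T.map (h.coverπ X)).naturality S.f
  have h₀ : IsZero D.L₀.X₂ := by
    have := h.left hS₂
    have : Mono D.v₁₂.τ₂ := inferInstanceAs (Mono ((T.flip.obj S.X₂).map _))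
    have h1 : D.v₀₁.τ₂ = 0 := by rw [← cancel_mono D.v₁₂.τ₂, D.w₀₂_τ₂, zero_comp]
    have : Mono D.v₀₁.τ₂ := mono_of_isLimit_fork D.h₀τ₂
    rw [IsZero.iff_id_eq_zero, ← cancel_mono D.v₀₁.τ₂, h1, comp_zero, comp_zero]
  have : Mono D.L₂'.f := D.mono_δ h₀
  have e₃ : kernel D.L₃.f ≅ D.L₀.X₃ :=
    (kernelIsKernel D.L₃.f).conePointUniqueUpToIso D.L₂'_exact.fIsKernel
  exact ⟨(kernel.mapIso _ _ e₁ e₂ comm).symm ≪≫ e₃ ≪≫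
    D.h₀τ₃.conePointUniqueUpToIso (limit.isLimit _)⟩

lemma FlatClass.isZero_tor₁ (X : A) {Y : A} (hY : flat Y) : IsZero (h.tor₁ X Y) := by
  have := h.left hY
  have : Mono ((T.map (kernel.ι (h.coverπ X))).app Y) :=
    inferInstanceAs (Mono ((T.flip.obj Y).map _))
  exact isZero_kernel_of_mono _

-- By balancing, the obstruction to injectivity on the left is `tor₁(X, S.X₃)`, which vanishes for
-- flat `S.X₃`; `X` is arbitrary.
include h in
lemma FlatClass.shortExact_map (X : A) {S : ShortComplex A} (hS : S.ShortExact)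
    (hS₂ : flat S.X₂) (hS₃ : flat S.X₃) : (S.map (T.obj X)).ShortExact := by
  obtain ⟨e⟩ := nonempty_kernel_iso_tor₁ h X hS hS₂
  have := hS.epi_g
  exact
    { exact := hS.exact.map_of_epi_of_preservesCokernel _ hS.epi_g inferInstance
      mono_f := Preadditive.mono_of_isZero_kernel _ ((h.isZero_tor₁ X hS₃).of_iso e)
      epi_g := inferInstanceAs (Epi ((T.obj X).map S.g)) }

end

/-! ### Cross products in the homology of a total complex -/

section

open HomologicalComplex

set_option linter.unusedSectionVars false

variable {A : Type u} [Category.{v} A] [Abelian A] [HasCoproducts.{0} A]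
  (T : A ⥤ A ⥤ A) [T.Additive] [∀ X, (T.obj X).Additive]

/-- The total complex of the bicomplex `T(X, K)`. -/
abbrev tot (X K : CochainComplex A ℤ) : CochainComplex A ℤ :=
  mapBifunctor X K T (ComplexShape.up ℤ)

variable (X K L : CochainComplex A ℤ)

/-- The inclusion of a summand in the total complex. -/
abbrev ιTot (i j n : ℤ) (h : i + j = n) : (T.obj (X.X i)).obj (K.X j) ⟶ (tot T X K).X n :=
  ιMapBifunctor X K T (ComplexShape.up ℤ) i j n h

lemma ιTot_d (i i' j j' n n' : ℤ) (h : i + j = n) (hi : i + 1 = i') (hj : j + 1 = j')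
    (hn : n + 1 = n') :
    ιTot T X K i j n h ≫ (tot T X K).d n n' =
      (T.map (X.d i i')).app (K.X j) ≫ ιTot T X K i' j n' (by lia) +
        i.negOnePow • (T.obj (X.X i)).map (K.d j j') ≫ ιTot T X K i j' n' (by lia) := by
  subst hi hj hn h
  rw [mapBifunctor.d_eq, Preadditive.comp_add, mapBifunctor.ι_D₁, mapBifunctor.ι_D₂,
    mapBifunctor.d₁_eq X K T (ComplexShape.up ℤ) (by simp) j (i + j + 1)
      (show i + 1 + j = i + j + 1 by lia),
    mapBifunctor.d₂_eq X K T (ComplexShape.up ℤ) i (show (ComplexShape.up ℤ).Rel j (j + 1) by simp)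
      (i + j + 1) (show i + (j + 1) = i + j + 1 by lia)]
  congr 1
  -- The total complex puts the sign `1` on the first differential.
  exact one_smul _ _

variable {K L} in
/-- The functoriality of the total complex in the second variable. -/
abbrev totMap (φ : K ⟶ L) : tot T X K ⟶ tot T X L :=
  mapBifunctorMap (𝟙 X) φ T (ComplexShape.up ℤ)

lemma ιTot_totMap (φ : K ⟶ L) (i j n : ℤ) (h : i + j = n) :
    ιTot T X K i j n h ≫ (totMap T X φ).f n =
      (T.obj (X.X i)).map (φ.f j) ≫ ιTot T X L i j n h := by
  rw [ι_mapBifunctorMap]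
  simp

variable {T X K L}
variable {M N : A} (i j n : ℤ) (h : i + j = n)

/-- The tensor product of cycles of `X` with a family `u` of cycles of `K`. -/
def crossCycles (u : M ⟶ K.X j) (hu : u ≫ K.d j (j + 1) = 0) :
    (T.obj (X.cycles i)).obj M ⟶ (tot T X K).cycles n :=
  (tot T X K).liftCycles ((T.map (X.iCycles i)).app M ≫ (T.obj (X.X i)).map u ≫ ιTot T X K i j n h)
    (n + 1) (by simp) (by
      rw [Category.assoc, Category.assoc, ιTot_d T X K i (i + 1) j (j + 1) n (n + 1) h rfl rfl rfl,
        Preadditive.comp_add, Preadditive.comp_add, Linear.comp_units_smul,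
        Linear.comp_units_smul, ← Functor.map_comp_assoc, hu, Functor.map_zero, zero_comp,
        comp_zero, smul_zero, add_zero, NatTrans.naturality_assoc, ← NatTrans.comp_app_assoc,
        ← T.map_comp, iCycles_d, T.map_zero]
      simp)

lemma crossCycles_iCycles (u : M ⟶ K.X j) (hu : u ≫ K.d j (j + 1) = 0) :
    crossCycles (T := T) (X := X) i j n h u hu ≫ (tot T X K).iCycles n =
      (T.map (X.iCycles i)).app M ≫ (T.obj (X.X i)).map u ≫ ιTot T X K i j n h :=
  liftCycles_i ..

lemma map_crossCycles (w : N ⟶ M) (u : M ⟶ K.X j) (hu : u ≫ K.d j (j + 1) = 0) :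
    (T.obj (X.cycles i)).map w ≫ crossCycles i j n h u hu =
      crossCycles i j n h (w ≫ u) (by rw [Category.assoc, hu, comp_zero]) := by
  rw [← cancel_mono ((tot T X K).iCycles n), Category.assoc, crossCycles_iCycles,
    crossCycles_iCycles, NatTrans.naturality_assoc, Functor.map_comp_assoc]

lemma crossCycles_totMap (φ : K ⟶ L) (u : M ⟶ K.X j) (hu : u ≫ K.d j (j + 1) = 0) :
    crossCycles (T := T) (X := X) i j n h u hu ≫ cyclesMap (totMap T X φ) n =
      crossCycles i j n h (u ≫ φ.f j) (by rw [Category.assoc, φ.comm, reassoc_of% hu, zero_comp]) := by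
  rw [← cancel_mono ((tot T X L).iCycles n), Category.assoc, cyclesMap_i, crossCycles_iCycles,
    reassoc_of% (crossCycles_iCycles (T := T) (X := X) i j n h u hu), ιTot_totMap,
    Functor.map_comp_assoc]

/-- `d(x ⊗ u) = dx ⊗ u` when `du = 0`. This lets the cross product descend to homology in `X`. -/
lemma toCycles_crossCycles (u : M ⟶ K.X j) (hu : u ≫ K.d j (j + 1) = 0) (i' n' : ℤ)
    (hi : i' + 1 = i) (hn : n' + 1 = n) :
    (T.map (X.toCycles i' i)).app M ≫ crossCycles i j n h u hu =
      (T.obj (X.X i')).map u ≫ ιTot T X K i' j n' (by lia) ≫ (tot T X K).toCycles n' n := by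
  rw [← cancel_mono ((tot T X K).iCycles n)]
  simp only [Category.assoc, crossCycles_iCycles, toCycles_i]
  rw [ιTot_d T X K i' i j (j + 1) n' n (by lia) hi rfl hn, Preadditive.comp_add,
    Linear.comp_units_smul, ← Functor.map_comp_assoc, hu, Functor.map_zero, zero_comp, smul_zero,
    add_zero, ← NatTrans.comp_app_assoc, ← T.map_comp, toCycles_i, NatTrans.naturality_assoc]

/-- `d(x ⊗ w) = (-1)ⁱ x ⊗ dw` for a cycle `x`. This lets the cross product descend to homology in
the second variable. -/
lemma crossCycles_boundary (w : M ⟶ K.X j) (j' n' : ℤ) (hj : j + 1 = j') (hn : n + 1 = n') :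
    crossCycles (T := T) (X := X) i j' n' (by lia) (w ≫ K.d j j') (by simp) =
      i.negOnePow • ((T.map (X.iCycles i)).app M ≫ (T.obj (X.X i)).map w ≫ ιTot T X K i j n h ≫
        (tot T X K).toCycles n n') := by
  rw [← cancel_mono ((tot T X K).iCycles n'), crossCycles_iCycles, Linear.units_smul_comp]
  simp only [Category.assoc, toCycles_i]
  rw [ιTot_d T X K i (i + 1) j j' n n' h rfl hj hn, Preadditive.comp_add, Preadditive.comp_add,
    NatTrans.naturality_assoc, ← NatTrans.comp_app_assoc, ← T.map_comp, iCycles_d, T.map_zero,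
    NatTrans.app_zero, zero_comp, zero_add, Linear.comp_units_smul, Linear.comp_units_smul,
    smul_smul, Int.units_mul_self, one_smul, Functor.map_comp_assoc]

variable [∀ X, PreservesFiniteColimits (T.obj X)] [∀ X, PreservesFiniteColimits (T.flip.obj X)]

instance (f : M ⟶ N) [Epi f] (P : A) : Epi ((T.map f).app P) :=
  inferInstanceAs (Epi ((T.flip.obj P).map f))

/-- `T(Hⁱ(X), M)` as a cokernel. -/
def isColimitHomology (i' : ℤ) (hi : i' + 1 = i) (M : A) :
    IsColimit (CokernelCofork.ofπ (f := (T.map (X.toCycles i' i)).app M)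
      ((T.map (X.homologyπ i)).app M)
      (by rw [← NatTrans.comp_app, ← T.map_comp, toCycles_comp_homologyπ, T.map_zero]; rfl)) :=
  CokernelCofork.mapIsColimit (CokernelCofork.ofπ (X.homologyπ i) (X.toCycles_comp_homologyπ i' i))
    (X.homologyIsCokernel i' i (by simp [← hi])) (T.flip.obj M)

lemma toCycles_crossCycles_homologyπ (u : M ⟶ K.X j) (hu : u ≫ K.d j (j + 1) = 0) :
    (T.map (X.toCycles (i - 1) i)).app M ≫ crossCycles i j n h u hu ≫ (tot T X K).homologyπ n = 0 := by
  rw [← Category.assoc, toCycles_crossCycles i j n h u hu (i - 1) (n - 1) (by lia) (by lia)]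
  simp

/-- The cross product `T(Hⁱ(X), M) ⟶ Hⁿ(T(X, K))` with a family `u` of cycles of `K`. -/
def cross (u : M ⟶ K.X j) (hu : u ≫ K.d j (j + 1) = 0) :
    (T.obj (X.homology i)).obj M ⟶ (tot T X K).homology n :=
  (isColimitHomology (T := T) (X := X) i (i - 1) (by lia) M).desc
    (CokernelCofork.ofπ (crossCycles i j n h u hu ≫ (tot T X K).homologyπ n)
      (toCycles_crossCycles_homologyπ i j n h u hu))

lemma homologyπ_cross (u : M ⟶ K.X j) (hu : u ≫ K.d j (j + 1) = 0) :
    (T.map (X.homologyπ i)).app M ≫ cross i j n h u hu =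
      crossCycles i j n h u hu ≫ (tot T X K).homologyπ n :=
  (isColimitHomology (T := T) (X := X) i (i - 1) (by lia) M).fac _ .one

lemma map_cross (w : N ⟶ M) (u : M ⟶ K.X j) (hu : u ≫ K.d j (j + 1) = 0) :
    (T.obj (X.homology i)).map w ≫ cross i j n h u hu =
      cross i j n h (w ≫ u) (by rw [Category.assoc, hu, comp_zero]) := by
  rw [← cancel_epi ((T.map (X.homologyπ i)).app N), homologyπ_cross, ← NatTrans.naturality_assoc,
    homologyπ_cross, reassoc_of% (map_crossCycles (T := T) (X := X) i j n h w u hu)]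

lemma cross_totMap (φ : K ⟶ L) (u : M ⟶ K.X j) (hu : u ≫ K.d j (j + 1) = 0) :
    cross (T := T) (X := X) i j n h u hu ≫ homologyMap (totMap T X φ) n =
      cross i j n h (u ≫ φ.f j) (by rw [Category.assoc, φ.comm, reassoc_of% hu, zero_comp]) := by
  rw [← cancel_epi ((T.map (X.homologyπ i)).app M), homologyπ_cross,
    reassoc_of% (homologyπ_cross (T := T) (X := X) i j n h u hu),
    homologyπ_naturality, ← Category.assoc, crossCycles_totMap]

lemma cross_boundary (w : M ⟶ K.X j) (j' n' : ℤ) (hj : j + 1 = j') (h' : i + j' = n') :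
    cross (T := T) (X := X) i j' n' h' (w ≫ K.d j j') (by simp) = 0 := by
  rw [← cancel_epi ((T.map (X.homologyπ i)).app M), homologyπ_cross,
    crossCycles_boundary i j (i + j) rfl w j' n' hj (by lia)]
  simp

variable (T X K)

lemma toCycles_cross : (T.obj (X.homology i)).map (K.toCycles (j - 1) j) ≫
    cross i j n h (K.iCycles j) (K.iCycles_d j (j + 1)) = 0 := by
  have e : K.toCycles (j - 1) j ≫ K.iCycles j = 𝟙 _ ≫ K.d (j - 1) j := by
    rw [toCycles_i, Category.id_comp]
  rw [map_cross]
  simp only [e]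
  exact cross_boundary i (j - 1) (𝟙 (K.X (j - 1))) j n (by lia) h

/-- `T(M, Hʲ(K))` as a cokernel. -/
def isColimitHomologyRight (M : A) (j' : ℤ) (hj : j' + 1 = j) :
    IsColimit (CokernelCofork.ofπ (f := (T.obj M).map (K.toCycles j' j))
      ((T.obj M).map (K.homologyπ j))
      (by rw [← Functor.map_comp, toCycles_comp_homologyπ, Functor.map_zero])) :=
  CokernelCofork.mapIsColimit (CokernelCofork.ofπ (K.homologyπ j) (K.toCycles_comp_homologyπ j' j))
    (K.homologyIsCokernel j' j (by simp [← hj])) (T.obj M)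

/-- The cross product in homology. -/
def crossHomology : (T.obj (X.homology i)).obj (K.homology j) ⟶ (tot T X K).homology n :=
  (isColimitHomologyRight T K j (X.homology i) (j - 1) (by lia)).desc
    (CokernelCofork.ofπ (cross i j n h (K.iCycles j) (K.iCycles_d j (j + 1))) (toCycles_cross T X K i j n h))

lemma homologyπ_crossHomology : (T.obj (X.homology i)).map (K.homologyπ j) ≫
    crossHomology T X K i j n h = cross i j n h (K.iCycles j) (K.iCycles_d j (j + 1)) :=
  (isColimitHomologyRight T K j (X.homology i) (j - 1) (by lia)).fac _ .one

end

/-! ### Exactness of coproducts -/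

section

set_option linter.unusedSectionVars false

variable {A : Type u} [Category.{v} A] [Abelian A] [HasCoproducts.{0} A] [AB4OfSize.{0} A]

section

variable {ι : Type} {X Y Z : ι → A}

/-- This is where AB4 enters. -/
instance mono_sigmaMap (f : ∀ p, X p ⟶ Y p) [∀ p, Mono (f p)] : Mono (Limits.Sigma.map f) := by
  have : ∀ p : Discrete ι, Mono ((Discrete.natTrans fun p : Discrete ι => f p.as :
      Discrete.functor X ⟶ Discrete.functor Y).app p) := fun p =>
    inferInstanceAs (Mono (f p.as))
  have := NatTrans.mono_of_mono_app (Discrete.natTrans fun p : Discrete ι => f p.as :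
      Discrete.functor X ⟶ Discrete.functor Y)
  exact inferInstanceAs (Mono (colim.map (Discrete.natTrans fun p : Discrete ι => f p.as :
      Discrete.functor X ⟶ Discrete.functor Y)))

lemma sigmaMap_comp (f : ∀ p, X p ⟶ Y p) (g : ∀ p, Y p ⟶ Z p) :
    Limits.Sigma.map f ≫ Limits.Sigma.map g = Limits.Sigma.map fun p => f p ≫ g p := by
  ext; simp

lemma sigmaMap_zero : Limits.Sigma.map (fun p => (0 : X p ⟶ Y p)) = 0 := by
  ext; simp

/-- Coproducts of short complexes. -/
abbrev sigmaShortComplex (S : ι → ShortComplex A) : ShortComplex A where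
  X₁ := ∐ fun p => (S p).X₁
  X₂ := ∐ fun p => (S p).X₂
  X₃ := ∐ fun p => (S p).X₃
  f := Limits.Sigma.map fun p => (S p).f
  g := Limits.Sigma.map fun p => (S p).g
  zero := by simp [sigmaMap_comp, sigmaMap_zero]

/-- Coproducts of morphisms of short complexes. -/
abbrev sigmaShortComplexMap {S S' : ι → ShortComplex A} (φ : ∀ p, S p ⟶ S' p) :
    sigmaShortComplex S ⟶ sigmaShortComplex S' where
  τ₁ := Limits.Sigma.map fun p => (φ p).τ₁
  τ₂ := Limits.Sigma.map fun p => (φ p).τ₂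
  τ₃ := Limits.Sigma.map fun p => (φ p).τ₃
  comm₁₂ := (sigmaMap_comp _ _).trans ((congrArg Limits.Sigma.map
    (funext fun p => (φ p).comm₁₂)).trans (sigmaMap_comp _ _).symm)
  comm₂₃ := (sigmaMap_comp _ _).trans ((congrArg Limits.Sigma.map
    (funext fun p => (φ p).comm₂₃)).trans (sigmaMap_comp _ _).symm)

lemma sigmaMap_isIso (f : ∀ p, X p ⟶ Y p) [∀ p, IsIso (f p)] : IsIso (Limits.Sigma.map f) :=
  (Limits.Sigma.mapIso fun p => asIso (f p)).isIso_hom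

/-- Coproducts commute with cokernels: a map out of the coproduct that kills the `f p` factors
summand by summand. -/
lemma exact_sigmaMap_of_epi (f : ∀ p, X p ⟶ Y p) (g : ∀ p, Y p ⟶ Z p) (w : ∀ p, f p ≫ g p = 0)
    (h : ∀ p, (ShortComplex.mk (f p) (g p) (w p)).Exact) [∀ p, Epi (g p)] :
    (ShortComplex.mk (Limits.Sigma.map f) (Limits.Sigma.map g)
      (by simp only [sigmaMap_comp, w, sigmaMap_zero])).Exact := by
  apply ShortComplex.exact_of_g_is_cokernel
  have key {W : A} (t : (∐ Y) ⟶ W) (ht : Limits.Sigma.map f ≫ t = 0) (p : ι) :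
      ∃ l : Z p ⟶ W, g p ≫ l = Limits.Sigma.ι Y p ≫ t := by
    have hp : f p ≫ Limits.Sigma.ι Y p ≫ t = 0 := by
      rw [← Limits.Sigma.ι_map_assoc, ht, comp_zero]
    have : Epi (ShortComplex.mk (f p) (g p) (w p)).g := inferInstanceAs (Epi (g p))
    exact ⟨(h p).desc _ hp, (h p).g_desc _ hp⟩
  choose l hl using @key
  refine CokernelCofork.IsColimit.ofπ (Limits.Sigma.map g) _
    (fun t ht => Limits.Sigma.desc (l t ht)) ?_ ?_
  · intro W t ht
    apply Limits.Sigma.hom_ext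
    intro p
    rw [Limits.Sigma.ι_map_assoc, Limits.Sigma.ι_desc, hl]
  · intro W t ht m hm
    apply Limits.Sigma.hom_ext
    intro p
    rw [← cancel_epi (g p), Limits.Sigma.ι_desc, hl, ← hm, Limits.Sigma.ι_map_assoc]

/-- Each `g` factors through the cokernel of `f` by a monomorphism. The cokernel part is the
preceding lemma, and the coproduct of the monomorphisms is a monomorphism. -/
lemma exact_sigmaShortComplex (S : ι → ShortComplex A) (hS : ∀ p, (S p).Exact) :
    (sigmaShortComplex S).Exact := by
  have hm (p : ι) : Mono (cokernel.desc (S p).f (S p).g (S p).zero) := (hS p).mono_cokernelDesc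
  let φ (p : ι) : ShortComplex.mk (S p).f (cokernel.π (S p).f) (cokernel.condition _) ⟶ S p :=
    { τ₁ := 𝟙 _
      τ₂ := 𝟙 _
      τ₃ := cokernel.desc (S p).f (S p).g (S p).zero
      comm₁₂ := by simp
      comm₂₃ := by simp }
  have : Epi (sigmaShortComplexMap φ).τ₁ := Limits.Sigma.map_epi fun p => 𝟙 (S p).X₁
  have : IsIso (sigmaShortComplexMap φ).τ₂ := sigmaMap_isIso fun p => 𝟙 (S p).X₂
  have : Mono (sigmaShortComplexMap φ).τ₃ :=
    mono_sigmaMap fun p => cokernel.desc (S p).f (S p).g (S p).zero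
  exact (ShortComplex.exact_iff_of_epi_of_isIso_of_mono (sigmaShortComplexMap φ)).1
    (exact_sigmaMap_of_epi _ _ _ fun p => ShortComplex.exact_cokernel (S p).f)

lemma isIso_sigmaDesc_comp_equiv {κ : Type} (e : ι ≃ κ) {F : κ → A} {W : A} (g : ∀ q, F q ⟶ W)
    [IsIso (Limits.Sigma.desc g)] : IsIso (Limits.Sigma.desc fun p => g (e p)) := by
  have : Limits.Sigma.desc (fun p => g (e p)) =
      (Limits.Sigma.reindex e F).hom ≫ Limits.Sigma.desc g := by
    apply Limits.Sigma.hom_ext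
    intro p
    rw [Limits.Sigma.ι_desc]
    exact ((Limits.Sigma.ι_reindex_hom_assoc e F p _).trans (Limits.Sigma.ι_desc _ _)).symm
  rw [this]
  exact IsIso.comp_isIso' (Iso.isIso_hom _) inferInstance

end

/-! ### Total complexes as coproducts -/

/-- `(a, b)` enumerates the pairs of integers with sum `n`. -/
structure Antidiagonal {ι : Type} (a b : ι → ℤ) (n : ℤ) : Prop where
  add (p : ι) : a p + b p = n
  bijective : Function.Bijective (fun p => (⟨(a p, b p), add p⟩ : {q : ℤ × ℤ // q.1 + q.2 = n}))

namespace Antidiagonal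

variable {ι : Type} {a b : ι → ℤ} {n : ℤ} (h : Antidiagonal a b n)

-- Neighbouring degrees of a total complex get the same index type, so that maps between them become
-- coproducts of maps over one index set.
include h in
lemma shift (k l m : ℤ) (hm : n + k + l = m) :
    Antidiagonal (fun p => a p + k) (fun p => b p + l) m where
  add p := by have := h.add p; lia
  bijective := by
    constructor
    · intro p q hpq
      apply h.bijective.1
      simp only [Subtype.mk.injEq, Prod.mk.injEq] at hpq ⊢
      lia
    · rintro ⟨⟨i, j⟩, hij⟩
      obtain ⟨p, hp⟩ := h.bijective.2 ⟨(i - k, j - l), by lia⟩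
      refine ⟨p, ?_⟩
      simp only [Subtype.mk.injEq, Prod.mk.injEq] at hp ⊢
      lia

variable (T : A ⥤ A ⥤ A) [T.Additive] [∀ X, (T.obj X).Additive] (X K : CochainComplex A ℤ)

/-- The comparison map of the coproduct with the total complex. -/
abbrev toTot : (∐ fun p => (T.obj (X.X (a p))).obj (K.X (b p))) ⟶ (tot T X K).X n :=
  Limits.Sigma.desc fun p => ιTot T X K (a p) (b p) n (h.add p)

instance isIso_toTot : IsIso (h.toTot T X K) := by
  let F (q : {q : ℤ × ℤ // q.1 + q.2 = n}) := (T.obj (X.X q.1.1)).obj (K.X q.1.2)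
  have h₀ : IsIso (Limits.Sigma.desc fun q : {q : ℤ × ℤ // q.1 + q.2 = n} =>
      ιTot T X K q.1.1 q.1.2 n q.2) := by
    refine ⟨HomologicalComplex.mapBifunctorDesc fun i j hij => Limits.Sigma.ι F ⟨(i, j), hij⟩,
      ?_, ?_⟩
    · apply Limits.Sigma.hom_ext
      intro q
      rw [Limits.Sigma.ι_desc_assoc, HomologicalComplex.ι_mapBifunctorDesc, Category.comp_id]
    · apply HomologicalComplex.mapBifunctor.hom_ext
      intro i j hij
      rw [HomologicalComplex.ι_mapBifunctorDesc_assoc, Limits.Sigma.ι_desc, Category.comp_id]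
  exact isIso_sigmaDesc_comp_equiv (Equiv.ofBijective _ h.bijective) fun
    q : {q : ℤ × ℤ // q.1 + q.2 = n} => ιTot T X K q.1.1 q.1.2 n q.2

end Antidiagonal

end

/-! ### The homology of `T(X, K)` for a complex `K` of flat objects with zero differential -/

section

open HomologicalComplex

set_option linter.unusedSectionVars false

/-- A comparison of kernels: since `φ.τ₃` is a monomorphism, `S'.f` lands in the kernel of `S.g`,
which is `S.X₁`. Exactness of `S'` is not needed. -/
lemma isIso_τ₁_of_exact {A : Type*} [Category* A] [Abelian A] {S S' : ShortComplex A}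
    (φ : S ⟶ S') (h : S.Exact) [Mono S.f] [Mono S'.f] [IsIso φ.τ₂] [Mono φ.τ₃] :
    IsIso φ.τ₁ := by
  have w : (S'.f ≫ inv φ.τ₂) ≫ S.g = 0 := by
    rw [← cancel_mono φ.τ₃, Category.assoc, ← φ.comm₂₃, Category.assoc, IsIso.inv_hom_id_assoc,
      S'.zero, zero_comp]
  refine ⟨h.lift _ w, ?_, ?_⟩
  · rw [← cancel_mono S.f, Category.assoc, h.lift_f, φ.comm₁₂_assoc, IsIso.hom_inv_id,
      Category.comp_id, Category.id_comp]
  · rw [← cancel_mono S'.f, Category.assoc, φ.comm₁₂, h.lift_f_assoc, Category.assoc,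
      IsIso.inv_hom_id, Category.comp_id, Category.id_comp]

lemma isIso_τ₃_of_exact {A : Type*} [Category* A] [Abelian A] {S S' : ShortComplex A}
    (φ : S ⟶ S') (h' : S'.Exact) [Epi S.g] [Epi S'.g] [Epi φ.τ₁] [IsIso φ.τ₂] :
    IsIso φ.τ₃ := by
  have w : S'.f ≫ inv φ.τ₂ ≫ S.g = 0 := by
    rw [← cancel_epi φ.τ₁, φ.comm₁₂_assoc, IsIso.hom_inv_id_assoc, S.zero, comp_zero]
  refine ⟨h'.desc _ w, ?_, ?_⟩
  · rw [← cancel_epi S.g, ← φ.comm₂₃_assoc, h'.g_desc, IsIso.hom_inv_id_assoc, Category.comp_id]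
  · rw [← cancel_epi S'.g, h'.g_desc_assoc, Category.assoc, ← φ.comm₂₃, IsIso.inv_hom_id_assoc,
      Category.comp_id]

variable {A : Type u} [Category.{v} A] [Abelian A] [HasCoproducts.{0} A] [AB4OfSize.{0} A]

lemma sigmaDesc_comp_eq {ι : Type} {F G : ι → A} {V W : A} {f : ∀ p, F p ⟶ V} {g : V ⟶ W}
    {m : ∀ p, F p ⟶ G p} {t : ∀ p, G p ⟶ W} (h : ∀ p, f p ≫ g = m p ≫ t p) :
    Limits.Sigma.desc f ≫ g = Limits.Sigma.map m ≫ Limits.Sigma.desc t := by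
  apply Limits.Sigma.hom_ext
  intro p
  rw [Limits.Sigma.ι_desc_assoc, Limits.Sigma.ι_map_assoc, Limits.Sigma.ι_desc, h]

variable
  {T : A ⥤ A ⥤ A} [T.Additive] [∀ X, (T.obj X).Additive]
  [∀ X, PreservesFiniteColimits (T.obj X)] [∀ X, PreservesFiniteColimits (T.flip.obj X)]
  {flat : A → Prop} (hT : FlatClass T flat) (X K : CochainComplex A ℤ)
  (hK : ∀ i j, K.d i j = 0) (hf : ∀ i, flat (K.X i))
  {ι : Type} {a b : ι → ℤ} {n : ℤ} (h : Antidiagonal a b n)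

namespace Antidiagonal

-- As `K` has zero differential, that of the total complex is `d ⊗ 1`. Tensoring with the flat `K.X
-- j` preserves kernels, so the cycles are the sums of `Zⁱ(X) ⊗ Kʲ`.
include hT hf in
lemma isIso_desc_crossCycles : IsIso (Limits.Sigma.desc fun p =>
    crossCycles (T := T) (X := X) (a p) (b p) n (h.add p) (𝟙 (K.X (b p))) (by simp [hK])) := by
  have (p : ι) := hT.left (hf (b p))
  let S := sigmaShortComplex fun p => ShortComplex.mk ((T.map (X.iCycles (a p))).app (K.X (b p)))
    ((T.map (X.d (a p) (a p + 1))).app (K.X (b p)))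
    (by rw [← NatTrans.comp_app, ← T.map_comp, iCycles_d, T.map_zero]; rfl)
  have hS : S.Exact := exact_sigmaShortComplex _ fun p => by
    have := ((T.flip.obj (K.X (b p))).preservesHomology_of_preservesMonos_and_cokernels)
    exact (ShortComplex.exact_of_f_is_kernel (ShortComplex.mk (X.iCycles (a p))
      (X.d (a p) (a p + 1)) (by simp)) (X.cyclesIsKernel (a p) (a p + 1) (by simp))).map
        (T.flip.obj (K.X (b p)))
  let S' := ShortComplex.mk ((tot T X K).iCycles n) ((tot T X K).d n (n + 1)) (by simp)
  let h' : Antidiagonal (fun p => a p + 1) b (n + 1) := by simpa using h.shift 1 0 (n + 1) (by lia)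
  have e₁ (p : ι) : crossCycles (T := T) (X := X) (a p) (b p) n (h.add p) (𝟙 (K.X (b p)))
      (by simp [hK]) ≫ (tot T X K).iCycles n =
      (T.map (X.iCycles (a p))).app (K.X (b p)) ≫ ιTot T X K (a p) (b p) n (h.add p) := by
    rw [crossCycles_iCycles, CategoryTheory.Functor.map_id, Category.id_comp]
  have e₂ (p : ι) : ιTot T X K (a p) (b p) n (h.add p) ≫ (tot T X K).d n (n + 1) =
      (T.map (X.d (a p) (a p + 1))).app (K.X (b p)) ≫
        ιTot T X K (a p + 1) (b p) (n + 1) (h'.add p) := by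
    rw [ιTot_d T X K (a p) (a p + 1) (b p) (b p + 1) n (n + 1) (h.add p) rfl rfl rfl,
      hK, Functor.map_zero, zero_comp, smul_zero, add_zero]
  let φ : S ⟶ S' :=
    { τ₁ := Limits.Sigma.desc fun p => crossCycles (a p) (b p) n (h.add p) (𝟙 _) (by simp [hK])
      τ₂ := h.toTot T X K
      τ₃ := h'.toTot T X K
      comm₁₂ := sigmaDesc_comp_eq e₁
      comm₂₃ := sigmaDesc_comp_eq e₂ }
  have : Mono S'.f := inferInstanceAs (Mono ((tot T X K).iCycles n))
  have : Mono S.f := by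
    have (p : ι) : Mono ((T.map (X.iCycles (a p))).app (K.X (b p))) :=
      inferInstanceAs (Mono ((T.flip.obj (K.X (b p))).map _))
    exact mono_sigmaMap fun p => (T.map (X.iCycles (a p))).app (K.X (b p))
  have : IsIso φ.τ₂ := h.isIso_toTot T X K
  have : Mono φ.τ₃ := (h'.isIso_toTot T X K).mono_of_iso
  exact isIso_τ₁_of_exact φ hS

-- Passing from cycles to homology is a cokernel, so right exactness suffices once the cycles are
-- known.
include hT hf in
lemma isIso_desc_cross : IsIso (Limits.Sigma.desc fun p =>
    cross (T := T) (X := X) (a p) (b p) n (h.add p) (𝟙 (K.X (b p))) (by simp [hK])) := by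
  let S := sigmaShortComplex fun p => ShortComplex.mk
    ((T.map (X.toCycles (a p - 1) (a p))).app (K.X (b p)))
    ((T.map (X.homologyπ (a p))).app (K.X (b p)))
    (by rw [← NatTrans.comp_app, ← T.map_comp, toCycles_comp_homologyπ, T.map_zero]; rfl)
  let S' := ShortComplex.mk ((tot T X K).toCycles (n - 1) n) ((tot T X K).homologyπ n) (by simp)
  have hS' : S'.Exact := ShortComplex.exact_of_g_is_cokernel _
    ((tot T X K).homologyIsCokernel (n - 1) n (by simp))
  let h' : Antidiagonal (fun p => a p - 1) b (n - 1) := by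
    simpa [← sub_eq_add_neg] using h.shift (-1) 0 (n - 1) (by lia)
  have e₁ (p : ι) : ιTot T X K (a p - 1) (b p) (n - 1) (h'.add p) ≫
      (tot T X K).toCycles (n - 1) n = (T.map (X.toCycles (a p - 1) (a p))).app (K.X (b p)) ≫
        crossCycles (T := T) (X := X) (a p) (b p) n (h.add p) (𝟙 (K.X (b p))) (by simp [hK]) := by
    rw [toCycles_crossCycles (a p) (b p) n (h.add p) (𝟙 (K.X (b p))) (by simp [hK])
      (a p - 1) (n - 1) (by lia) (by lia), CategoryTheory.Functor.map_id, Category.id_comp]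
  have e₂ (p : ι) := (homologyπ_cross (T := T) (X := X) (a p) (b p) n (h.add p) (𝟙 (K.X (b p)))
    (by simp [hK])).symm
  let φ : S ⟶ S' :=
    { τ₁ := h'.toTot T X K
      τ₂ := Limits.Sigma.desc fun p => crossCycles (a p) (b p) n (h.add p) (𝟙 _) (by simp [hK])
      τ₃ := Limits.Sigma.desc fun p => cross (a p) (b p) n (h.add p) (𝟙 _) (by simp [hK])
      comm₁₂ := sigmaDesc_comp_eq e₁
      comm₂₃ := sigmaDesc_comp_eq e₂ }
  have : Epi S'.g := inferInstanceAs (Epi ((tot T X K).homologyπ n))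
  have : Epi S.g := Limits.Sigma.map_epi fun p => (T.map (X.homologyπ (a p))).app (K.X (b p))
  have : Epi φ.τ₁ := (h'.isIso_toTot T X K).epi_of_iso
  have : IsIso φ.τ₂ := h.isIso_desc_crossCycles hT X K hK hf
  exact isIso_τ₃_of_exact φ hS'

end Antidiagonal

end

/-! ### The Künneth sequence -/

section

open HomologicalComplex

set_option linter.unusedSectionVars false

/-- Cuts a five-term exact sequence at its middle term: `C` is the cokernel of the first map and `D`
the kernel of the last. -/
lemma exists_shortExact_of_exact {A : Type*} [Category* A] [Abelian A] {B₁ B₂ C A₃ A₄ A₅ D : A}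
    {u : B₁ ⟶ B₂} {a : B₂ ⟶ A₃} {b : A₃ ⟶ A₄} {d : A₄ ⟶ A₅} {q : B₂ ⟶ C} {k : D ⟶ A₄}
    (ua : u ≫ a = 0) (hua : (ShortComplex.mk u a ua).Exact)
    (ab : a ≫ b = 0) (hab : (ShortComplex.mk a b ab).Exact)
    (bd : b ≫ d = 0) (hbd : (ShortComplex.mk b d bd).Exact)
    (uq : u ≫ q = 0) (huq : (ShortComplex.mk u q uq).Exact) [Epi q]
    (kd : k ≫ d = 0) (hkd : (ShortComplex.mk k d kd).Exact) [Mono k] :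
    ∃ (f : C ⟶ A₃) (g : A₃ ⟶ D) (fg : f ≫ g = 0), q ≫ f = a ∧ g ≫ k = b ∧
      (ShortComplex.mk f g fg).ShortExact := by
  have : Epi (ShortComplex.mk u q uq).g := inferInstanceAs (Epi q)
  have : Mono (ShortComplex.mk k d kd).f := inferInstanceAs (Mono k)
  obtain ⟨f, hf⟩ : ∃ f : C ⟶ A₃, q ≫ f = a := ⟨huq.desc a ua, huq.g_desc a ua⟩
  obtain ⟨g, hg⟩ : ∃ g : A₃ ⟶ D, g ≫ k = b := ⟨hkd.lift b bd, hkd.lift_f b bd⟩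
  have fg : f ≫ g = 0 := by
    rw [← cancel_epi q, ← cancel_mono k, Category.assoc, Category.assoc, hg, reassoc_of% hf, ab]
    simp
  have hfm : Mono f := by
    refine Preadditive.mono_of_cancel_zero f fun {T} x hx => ?_
    obtain ⟨T', π, _, y, hy⟩ := surjective_up_to_refinements_of_epi q x
    have hya : y ≫ a = 0 := by rw [← hf, ← reassoc_of% hy, hx, comp_zero]
    obtain ⟨T'', π', _, z, hz⟩ := hua.exact_up_to_refinements y hya
    dsimp at hz
    rw [← cancel_epi π, ← cancel_epi π', hy, reassoc_of% hz, uq, comp_zero, comp_zero, comp_zero]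
  have hge : Epi g := by
    rw [epi_iff_surjective_up_to_refinements]
    intro T x
    obtain ⟨T', π, hπ, y, hy⟩ := hbd.exact_up_to_refinements (x ≫ k) (by
      dsimp; rw [Category.assoc, kd, comp_zero])
    dsimp at hy
    exact ⟨T', π, hπ, y, by rw [← cancel_mono k, Category.assoc, hy, Category.assoc, hg]⟩
  refine ⟨f, g, fg, hf, hg, { exact := ?_, mono_f := hfm, epi_g := hge }⟩
  rw [ShortComplex.exact_iff_exact_up_to_refinements]
  intro T x hx
  dsimp at x hx
  obtain ⟨T', π, hπ, y, hy⟩ := hab.exact_up_to_refinements x (by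
    exact (x ≫= hg.symm).trans ((reassoc_of% hx) k |>.trans zero_comp))
  dsimp at hy
  exact ⟨T', π, hπ, y ≫ q, by dsimp; rw [hy, Category.assoc, hf]⟩

variable {A : Type u} [Category.{v} A] [Abelian A]

/-! ### Cycles and boundaries of a complex -/

section cyclesComplex

variable (P : CochainComplex A ℤ)

/-- The subcomplex of cycles. -/
abbrev cyclesComplex : CochainComplex A ℤ where
  X j := P.cycles j
  d _ _ := 0

/-- The quotient of a complex by its cycles. -/
abbrev modCycles : CochainComplex A ℤ where
  X j := cokernel (P.iCycles j)
  d _ _ := 0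

/-- The inclusion of the cycles. -/
def cyclesIncl : cyclesComplex P ⟶ P where
  f j := P.iCycles j
  comm' i j _ := (P.iCycles_d i j).trans zero_comp.symm

/-- The projection to the quotient by the cycles. -/
def modCyclesProj : P ⟶ modCycles P where
  f j := cokernel.π (P.iCycles j)
  comm' i j _ := by
    rw [← P.toCycles_i i j, Category.assoc, cokernel.condition, comp_zero, comp_zero]

instance (j : ℤ) : Epi ((modCyclesProj P).f j) := inferInstanceAs (Epi (cokernel.π _))

lemma iCycles_toCycles (j j' : ℤ) : P.iCycles j ≫ P.toCycles j j' = 0 := by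
  rw [← cancel_mono (P.iCycles j'), Category.assoc, toCycles_i, iCycles_d, zero_comp]

/-- The identification of the quotient by the cycles with the boundaries. -/
def modCyclesToCycles (j j' : ℤ) : (modCycles P).X j ⟶ (cyclesComplex P).X j' :=
  cokernel.desc _ (P.toCycles j j') (iCycles_toCycles P j j')

lemma proj_modCyclesToCycles (j j' : ℤ) :
    (modCyclesProj P).f j ≫ modCyclesToCycles P j j' = P.toCycles j j' :=
  cokernel.π_desc _ _ _

/-- The cycles are the kernel of the differential. The embedding makes the quotient by the cycles
flat when the terms of `P` are. -/
lemma mono_modCyclesToCycles {j j' : ℤ} (h : j + 1 = j') : Mono (modCyclesToCycles P j j') := by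
  let φ : ShortComplex.mk _ _ (iCycles_toCycles P j j') ⟶ ShortComplex.mk _ _ (P.iCycles_d j j') :=
    { τ₁ := 𝟙 _
      τ₂ := 𝟙 _
      τ₃ := P.iCycles j' }
  have : Epi φ.τ₁ := inferInstanceAs (Epi (𝟙 _))
  have : IsIso φ.τ₂ := inferInstanceAs (IsIso (𝟙 _))
  have : Mono φ.τ₃ := inferInstanceAs (Mono (P.iCycles j'))
  exact ((ShortComplex.exact_iff_of_epi_of_isIso_of_mono φ).2
    (ShortComplex.exact_of_f_is_kernel _ (P.cyclesIsKernel j j' (by simp [h])))).mono_cokernelDesc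

lemma modCyclesToCycles_homologyπ (j j' : ℤ) :
    modCyclesToCycles P j j' ≫ P.homologyπ j' = 0 := by
  rw [← cancel_epi ((modCyclesProj P).f j), reassoc_of% (proj_modCyclesToCycles P j j'),
    toCycles_comp_homologyπ,
    comp_zero]

/-- For `P` with flat terms this is a flat presentation of `Hʲ'(P)`, from which both terms of the
Künneth sequence are read off. -/
lemma shortExact_modCyclesToCycles {j j' : ℤ} (h : j + 1 = j') :
    (ShortComplex.mk _ _ (modCyclesToCycles_homologyπ P j j')).ShortExact := by
  let φ : ShortComplex.mk _ _ (P.toCycles_comp_homologyπ j j') ⟶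
      ShortComplex.mk _ _ (modCyclesToCycles_homologyπ P j j') :=
    { τ₁ := (modCyclesProj P).f j
      τ₂ := 𝟙 _
      τ₃ := 𝟙 _
      comm₁₂ := (proj_modCyclesToCycles P j j').trans (Category.comp_id _).symm
      comm₂₃ := (Category.id_comp _).trans (Category.comp_id _).symm }
  have : Epi φ.τ₁ := inferInstanceAs (Epi (cokernel.π _))
  have : IsIso φ.τ₂ := inferInstanceAs (IsIso (𝟙 _))
  have : Mono φ.τ₃ := inferInstanceAs (Mono (𝟙 _))
  exact
    { exact := (ShortComplex.exact_iff_of_epi_of_isIso_of_mono φ).1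
        (ShortComplex.exact_of_g_is_cokernel _ (P.homologyIsCokernel j j' (by simp [← h])))
      mono_f := mono_modCyclesToCycles P h
      epi_g := inferInstanceAs (Epi (P.homologyπ j')) }

lemma shortExact_cycles (j : ℤ) : (ShortComplex.mk ((cyclesIncl P).f j) ((modCyclesProj P).f j)
    (cokernel.condition _)).ShortExact where
  exact := ShortComplex.exact_cokernel _
  mono_f := inferInstanceAs (Mono (P.iCycles j))
  epi_g := inferInstance

end cyclesComplex

variable [HasCoproducts.{0} A] [AB4OfSize.{0} A]
  {T : A ⥤ A ⥤ A} [T.Additive] [∀ X, (T.obj X).Additive]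
  [∀ X, PreservesFiniteColimits (T.obj X)] [∀ X, PreservesFiniteColimits (T.flip.obj X)]
  {flat : A → Prop} (hT : FlatClass T flat) (X P : CochainComplex A ℤ)
  (hP : ∀ i, flat (P.X i))

include hT hP in
lemma flat_cyclesComplex (j : ℤ) : flat ((cyclesComplex P).X j) :=
  hT.of_mono (hP j) (P.iCycles j)

include hT hP in
lemma flat_modCycles (j : ℤ) : flat ((modCycles P).X j) :=
  have := mono_modCyclesToCycles P (j := j) rfl
  hT.of_mono (flat_cyclesComplex hT P hP (j + 1)) (modCyclesToCycles P j (j + 1))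

variable (T) in
/-- The sequence of total complexes induced by the cycles of `P`. -/
abbrev totCycles : ShortComplex (CochainComplex A ℤ) where
  X₁ := tot T X (cyclesComplex P)
  X₂ := tot T X P
  X₃ := tot T X (modCycles P)
  f := totMap T X (cyclesIncl P)
  g := totMap T X (modCyclesProj P)
  zero := by
    ext n : 1
    apply mapBifunctor.hom_ext
    intro i j hij
    have e : (cyclesIncl P).f j ≫ (modCyclesProj P).f j = 0 := cokernel.condition _
    refine ((Category.assoc _ _ _).symm.trans
      (congrArg (· ≫ _) (ιTot_totMap T X _ _ (cyclesIncl P) i j n hij))).trans ?_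
    rw [Category.assoc, ιTot_totMap T X _ _ (modCyclesProj P) i j n hij, ← Functor.map_comp_assoc, e,
      Functor.map_zero, zero_comp]
    exact comp_zero.symm

lemma Antidiagonal.canonical (n : ℤ) : Antidiagonal (fun q : {q : ℤ × ℤ // q.1 + q.2 = n} => q.1.1)
    (fun q => q.1.2) n where
  add q := q.2
  bijective := Function.bijective_id

-- In each degree this is a coproduct of images under `T(Xⁱ, -)` of the sequences of cycles, which
-- remain exact because the quotients are flat.
include hT hP in
lemma shortExact_totCycles : (totCycles T X P).ShortExact := by
  apply shortExact_of_degreewise_shortExact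
  intro n
  have h := Antidiagonal.canonical n
  let S := sigmaShortComplex fun q : {q : ℤ × ℤ // q.1 + q.2 = n} => (ShortComplex.mk
    ((cyclesIncl P).f q.1.2) ((modCyclesProj P).f q.1.2) (cokernel.condition _)).map (T.obj (X.X q.1.1))
  have hp (q : {q : ℤ × ℤ // q.1 + q.2 = n}) :=
    hT.shortExact_map (X.X q.1.1) (shortExact_cycles P q.1.2) (hP _) (flat_modCycles hT P hP _)
  have hS : S.ShortExact :=
    { exact := exact_sigmaShortComplex _ fun q => (hp q).exact
      mono_f := by
        have (q : {q : ℤ × ℤ // q.1 + q.2 = n}) :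
            Mono ((T.obj (X.X q.1.1)).map ((cyclesIncl P).f q.1.2)) := (hp q).mono_f
        exact mono_sigmaMap fun q : {q : ℤ × ℤ // q.1 + q.2 = n} =>
          (T.obj (X.X q.1.1)).map ((cyclesIncl P).f q.1.2)
      epi_g := by
        have (q : {q : ℤ × ℤ // q.1 + q.2 = n}) :
            Epi ((T.obj (X.X q.1.1)).map ((modCyclesProj P).f q.1.2)) := (hp q).epi_g
        exact Limits.Sigma.map_epi fun q : {q : ℤ × ℤ // q.1 + q.2 = n} =>
          (T.obj (X.X q.1.1)).map ((modCyclesProj P).f q.1.2) }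
  have i₁ := h.isIso_toTot T X (cyclesComplex P)
  have i₂ := h.isIso_toTot T X P
  have i₃ := h.isIso_toTot T X (modCycles P)
  refine ShortComplex.shortExact_of_iso (ShortComplex.isoMk (@asIso _ _ _ _ _ i₁)
    (@asIso _ _ _ _ _ i₂) (@asIso _ _ _ _ _ i₃) ?_ ?_) hS
  · exact sigmaDesc_comp_eq fun q : {q : ℤ × ℤ // q.1 + q.2 = n} =>
      ιTot_totMap T X _ _ (cyclesIncl P) q.1.1 q.1.2 n q.2
  · exact sigmaDesc_comp_eq fun q : {q : ℤ × ℤ // q.1 + q.2 = n} =>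
      ιTot_totMap T X _ _ (modCyclesProj P) q.1.1 q.1.2 n q.2

/-- The class of `x ⊗ [p]` lifts to `x ⊗ p` in `X ⊗ P`, whose differential is `(-1)ⁱ x ⊗ dp` because
`x` is a cycle. -/
lemma cross_proj_δ (hS : (totCycles T X P).ShortExact) (i j n j' n' : ℤ) (h : i + j = n)
    (hj : j + 1 = j') (hn : (ComplexShape.up ℤ).Rel n n') :
    cross (T := T) (X := X) (K := modCycles P) i j n h ((modCyclesProj P).f j) comp_zero ≫
      hS.δ n n' hn =
      i.negOnePow • cross (T := T) (X := X) (K := cyclesComplex P) i j' n' (by have : n + 1 = n' := hn; lia)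
        (P.toCycles j j') comp_zero := by
  obtain rfl : n + 1 = n' := id hn
  subst hj
  rw [← cancel_epi ((T.map (X.homologyπ i)).app (P.X j)),
    reassoc_of% (homologyπ_cross (T := T) (X := X) (K := modCycles P) i j n h
      ((modCyclesProj P).f j) comp_zero),
    Linear.comp_units_smul, homologyπ_cross]
  -- `x₂` is the lift `x ⊗ p`, and `x₁` is its differential, viewed in the total complex of the
  -- cycles of `P`.
  let x₂ := (T.map (X.iCycles i)).app (P.X j) ≫ ιTot T X P i j n h
  let x₁ := i.negOnePow • ((T.map (X.iCycles i)).app (P.X j) ≫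
    (T.obj (X.X i)).map (P.toCycles j (j + 1)) ≫
      ιTot T X (cyclesComplex P) i (j + 1) (n + 1) (by lia))
  have hx₂ : x₂ ≫ (totMap T X (modCyclesProj P)).f n = (T.map (X.iCycles i)).app (P.X j) ≫
      (T.obj (X.X i)).map ((modCyclesProj P).f j) ≫ ιTot T X (modCycles P) i j n h := by
    rw [Category.assoc, ιTot_totMap]
  have e := P.toCycles_i j (j + 1)
  have hx₁ : x₁ ≫ (totMap T X (cyclesIncl P)).f (n + 1) = x₂ ≫ (tot T X P).d n (n + 1) := by
    rw [Category.assoc, ιTot_d T X P i (i + 1) j (j + 1) n (n + 1) h rfl rfl rfl,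
      Preadditive.comp_add, ← NatTrans.comp_app_assoc, ← T.map_comp,
      iCycles_d, T.map_zero, NatTrans.app_zero, zero_comp, zero_add, Linear.units_smul_comp,
      Linear.comp_units_smul, Category.assoc, Category.assoc, ιTot_totMap,
      ← Functor.map_comp_assoc]
    exact congrArg (fun t => i.negOnePow • ((T.map (X.iCycles i)).app (P.X j) ≫
      (T.obj (X.X i)).map t ≫ ιTot T X P i (j + 1) (n + 1) (by lia))) e
  have hx₃ : ((T.map (X.iCycles i)).app (P.X j) ≫
      (T.obj (X.X i)).map ((modCyclesProj P).f j) ≫ ιTot T X (modCycles P) i j n h) ≫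
        (tot T X (modCycles P)).d n (n + 1) = 0 := by
    rw [← crossCycles_iCycles i j n h ((modCyclesProj P).f j) comp_zero, Category.assoc,
      iCycles_d, comp_zero]
  refine (hS.δ_eq n (n + 1) hn _ hx₃ x₂ hx₂ x₁ hx₁ (n + 1 + 1) (by simp)).trans ?_
  rw [← Linear.units_smul_comp]
  refine congrArg (· ≫ (tot T X (cyclesComplex P)).homologyπ (n + 1)) ?_
  rw [← cancel_mono ((tot T X (cyclesComplex P)).iCycles (n + 1)), Linear.units_smul_comp,
    crossCycles_iCycles]
  exact liftCycles_i ..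

lemma cross_δ (hS : (totCycles T X P).ShortExact) (i j n j' n' : ℤ) (h : i + j = n)
    (hj : j + 1 = j') (hn : (ComplexShape.up ℤ).Rel n n') :
    cross (T := T) (X := X) (K := modCycles P) i j n h (𝟙 _) comp_zero ≫ hS.δ n n' hn =
      (i.negOnePow • (T.obj (X.homology i)).map (modCyclesToCycles P j j')) ≫
        cross (T := T) (X := X) (K := cyclesComplex P) i j' n' (by have : n + 1 = n' := hn; lia)
          (𝟙 _) comp_zero := by
  rw [← cancel_epi ((T.obj (X.homology i)).map ((modCyclesProj P).f j)),
    reassoc_of% (map_cross (T := T) (X := X) (K := modCycles P) i j n h ((modCyclesProj P).f j)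
      (𝟙 _) comp_zero),
    Linear.units_smul_comp, map_cross, Linear.comp_units_smul, map_cross]
  have e : (modCyclesProj P).f j ≫ modCyclesToCycles P j j' ≫ 𝟙 ((cyclesComplex P).X j') =
      P.toCycles j j' := by
    rw [Category.comp_id, proj_modCyclesToCycles]
  simp only [e]
  exact cross_proj_δ X P hS i j n j' n' h hj hn

end

section

open HomologicalComplex

set_option linter.unusedSectionVars false

variable {A : Type u} [Category.{v} A] [Abelian A]

/-! ### Exactness is insensitive to signs -/

lemma epi_units_smul {M N : A} (ε : ℤˣ) (f : M ⟶ N) [Epi f] : Epi (ε • f) where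
  left_cancellation g g' e := by
    rw [Linear.units_smul_comp, Linear.units_smul_comp] at e
    exact (cancel_epi f).1 (smul_left_cancel ε e)

lemma mono_units_smul {M N : A} (ε : ℤˣ) (f : M ⟶ N) [Mono f] : Mono (ε • f) where
  right_cancellation g g' e := by
    rw [Linear.comp_units_smul, Linear.comp_units_smul] at e
    exact (cancel_mono f).1 (smul_left_cancel ε e)

lemma exact_units_smul {S : ShortComplex A} (ε : ℤˣ) (w : (ε • S.f) ≫ S.g = 0) (hS : S.Exact) :
    (ShortComplex.mk (ε • S.f) S.g w).Exact := by
  let φ : ShortComplex.mk (ε • S.f) S.g w ⟶ S :=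
    { τ₁ := ε • 𝟙 _
      τ₂ := 𝟙 _
      τ₃ := 𝟙 _
      comm₁₂ := by
        rw [Linear.units_smul_comp, Category.id_comp]
        exact (Category.comp_id _).symm
      comm₂₃ := (Category.id_comp _).trans (Category.comp_id _).symm }
  have : Epi φ.τ₁ := epi_units_smul ε (𝟙 _)
  have : IsIso φ.τ₂ := inferInstanceAs (IsIso (𝟙 _))
  have : Mono φ.τ₃ := inferInstanceAs (Mono (𝟙 _))
  exact (ShortComplex.exact_iff_of_epi_of_isIso_of_mono φ).2 hS

lemma exact_kernel_units_smul {M N L : A} (ε : ℤˣ) (f : M ⟶ N) (e : kernel f ≅ L) :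
    (ShortComplex.mk (e.inv ≫ kernel.ι f) (ε • f) (by
      rw [Linear.comp_units_smul, Category.assoc, kernel.condition, comp_zero, smul_zero])).Exact := by
  let φ : ShortComplex.mk (e.inv ≫ kernel.ι f) (ε • f) (by
      rw [Linear.comp_units_smul, Category.assoc, kernel.condition, comp_zero, smul_zero]) ⟶
      ShortComplex.mk (kernel.ι f) f (kernel.condition f) :=
    { τ₁ := e.inv
      τ₂ := 𝟙 _
      τ₃ := ε • 𝟙 _
      comm₁₂ := (Category.comp_id _).symm
      comm₂₃ := by
        have h : f = (ε • f) ≫ (ε • 𝟙 N) := by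
          rw [Linear.units_smul_comp, Linear.comp_units_smul, smul_smul, Int.units_mul_self,
            one_smul, Category.comp_id]
        exact (Category.id_comp f).trans h }
  have : Epi φ.τ₁ := inferInstanceAs (Epi e.inv)
  have : IsIso φ.τ₂ := inferInstanceAs (IsIso (𝟙 _))
  have : Mono φ.τ₃ := mono_units_smul ε (𝟙 _)
  exact (ShortComplex.exact_iff_of_epi_of_isIso_of_mono φ).2
    (ShortComplex.exact_of_f_is_kernel _ (kernelIsKernel f))

variable [HasCoproducts.{0} A] [AB4OfSize.{0} A]
  {T : A ⥤ A ⥤ A} [T.Additive] [∀ X, (T.obj X).Additive]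
  [∀ X, PreservesFiniteColimits (T.obj X)] [∀ X, PreservesFiniteColimits (T.flip.obj X)]
  {flat : A → Prop} (hT : FlatClass T flat) (X P : CochainComplex A ℤ)
  (hP : ∀ i, flat (P.X i))

include hP in
set_option maxHeartbeats 1600000 in
/-- The Künneth sequence for a complex `P` of flat objects. -/
theorem exists_kunneth_shortExact {ι κ : Type} {a b : ι → ℤ} {a' c' : κ → ℤ} {n : ℤ}
    (h : Antidiagonal a b n) (h' : Antidiagonal a' c' (n + 1)) :
    ∃ (f : (∐ fun p => (T.obj (X.homology (a p))).obj (P.homology (b p))) ⟶ (tot T X P).homology n)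
      (g : (tot T X P).homology n ⟶ ∐ fun q => hT.tor₁ (X.homology (a' q)) (P.homology (c' q)))
      (fg : f ≫ g = 0), (ShortComplex.mk f g fg).ShortExact ∧
      ∀ p, Limits.Sigma.ι (fun p => (T.obj (X.homology (a p))).obj (P.homology (b p))) p ≫ f =
        crossHomology T X P (a p) (b p) n (h.add p) := by
  have hS := shortExact_totCycles hT X P hP
  have rel : (ComplexShape.up ℤ).Rel (n - 1) n := by simp
  have rel' : (ComplexShape.up ℤ).Rel n (n + 1) := by simp
  -- The connecting maps raise the second degree by one, so their sources are indexed like their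
  -- targets with the second index lowered.
  have hb : Antidiagonal a (fun p => b p - 1) (n - 1) := by
    simpa [← sub_eq_add_neg] using h.shift 0 (-1) (n - 1) (by lia)
  have hc : Antidiagonal a' (fun q => c' q - 1) n := by
    simpa [← sub_eq_add_neg] using h'.shift 0 (-1) n (by lia)
  have fZ := flat_cyclesComplex hT P hP
  have fB := flat_modCycles hT P hP
  let α : (tot T X (cyclesComplex P)).homology n ⟶ (tot T X P).homology n :=
    homologyMap (totMap T X (cyclesIncl P)) n
  let β : (tot T X P).homology n ⟶ (tot T X (modCycles P)).homology n :=
    homologyMap (totMap T X (modCyclesProj P)) n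
  let δ : (tot T X (modCycles P)).homology n ⟶ (tot T X (cyclesComplex P)).homology (n + 1) :=
    hS.δ n (n + 1) rel'
  let δ' : (tot T X (modCycles P)).homology (n - 1) ⟶ (tot T X (cyclesComplex P)).homology n :=
    hS.δ (n - 1) n rel
  have hδα : δ' ≫ α = 0 := hS.δ_comp (n - 1) n rel
  have hαβ : α ≫ β = 0 := (homologyMap_comp _ _ n).symm.trans
    ((congrArg (homologyMap · n) (totCycles T X P).zero).trans (homologyMap_zero _ _ n))
  have hβδ : β ≫ δ = 0 := hS.comp_δ n (n + 1) rel'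
  -- the homology of the outer complexes
  let α₁ := Limits.Sigma.desc fun p => cross (T := T) (X := X) (K := cyclesComplex P)
    (a p) (b p) n (h.add p) (𝟙 _) comp_zero
  have iα₁ : IsIso α₁ := h.isIso_desc_cross hT X (cyclesComplex P) (fun _ _ => rfl) fZ
  let β₁ := Limits.Sigma.desc fun p => cross (T := T) (X := X) (K := modCycles P)
    (a p) (b p - 1) (n - 1) (hb.add p) (𝟙 _) comp_zero
  have iβ₁ : IsIso β₁ := hb.isIso_desc_cross hT X (modCycles P) (fun _ _ => rfl) fB
  let β₂ := Limits.Sigma.desc fun q => cross (T := T) (X := X) (K := modCycles P)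
    (a' q) (c' q - 1) n (hc.add q) (𝟙 _) comp_zero
  have iβ₂ : IsIso β₂ := hc.isIso_desc_cross hT X (modCycles P) (fun _ _ => rfl) fB
  let γ := Limits.Sigma.desc fun q => cross (T := T) (X := X) (K := cyclesComplex P)
    (a' q) (c' q) (n + 1) (h'.add q) (𝟙 _) comp_zero
  have iγ : IsIso γ := h'.isIso_desc_cross hT X (cyclesComplex P) (fun _ _ => rfl) fZ
  -- the connecting morphisms
  let m (p : ι) := (a p).negOnePow •
    (T.obj (X.homology (a p))).map (modCyclesToCycles P (b p - 1) (b p))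
  have e₁ (p : ι) := cross_δ X P hS (a p) (b p - 1) (n - 1) (b p) n (hb.add p) (by lia) rel
  have e₁' : β₁ ≫ δ' = Limits.Sigma.map m ≫ α₁ := sigmaDesc_comp_eq e₁
  let m' (q : κ) := (a' q).negOnePow •
    (T.obj (X.homology (a' q))).map (modCyclesToCycles P (c' q - 1) (c' q))
  have e₂ (q : κ) := cross_δ X P hS (a' q) (c' q - 1) n (c' q) (n + 1) (hc.add q) (by lia) rel'
  have e₂' : β₂ ≫ δ = Limits.Sigma.map m' ≫ γ := sigmaDesc_comp_eq e₂
  -- the cokernel of the first one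
  have hses' (p : ι) := shortExact_modCyclesToCycles P (show b p - 1 + 1 = b p by lia)
  let π (p : ι) := (T.obj (X.homology (a p))).map (P.homologyπ (b p))
  have hmπ (p : ι) : m p ≫ π p = 0 := by
    rw [Linear.units_smul_comp, ← Functor.map_comp, modCyclesToCycles_homologyπ, Functor.map_zero,
      smul_zero]
  have epiπ (p : ι) : Epi (π p) := inferInstanceAs (Epi ((T.obj _).map _))
  have hmπe (p : ι) : (ShortComplex.mk (m p) (π p) (hmπ p)).Exact := by
    exact exact_units_smul _ _ ((hses' p).exact.map_of_epi_of_preservesCokernel (T.obj _)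
      (hses' p).epi_g inferInstance)
  have uq : Limits.Sigma.map m ≫ Limits.Sigma.map π = 0 := by
    simp only [sigmaMap_comp, hmπ, sigmaMap_zero]
  have huq : (ShortComplex.mk _ _ uq).Exact := exact_sigmaMap_of_epi m π hmπ hmπe
  -- the kernel of the second one
  have hses (q : κ) := shortExact_modCyclesToCycles P (show c' q - 1 + 1 = c' q by lia)
  -- Balancing, applied to the presentation of `H(P)` by boundaries and cycles, turns the kernel of
  -- the connecting map into `tor₁`.
  let i (q : κ) := (nonempty_kernel_iso_tor₁ hT (X.homology (a' q)) (hses q) (fZ (c' q))).some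
  let k (q : κ) := (i q).inv ≫ kernel.ι _
  have hkm (q : κ) := exact_kernel_units_smul (a' q).negOnePow
    ((T.obj (X.homology (a' q))).map (modCyclesToCycles P (c' q - 1) (c' q))) (i q)
  have km₀ (q : κ) : k q ≫ m' q = 0 := by
    rw [Linear.comp_units_smul, Category.assoc, kernel.condition, comp_zero, smul_zero]
  have km : Limits.Sigma.map k ≫ Limits.Sigma.map m' = 0 := by
    simp only [sigmaMap_comp, km₀, sigmaMap_zero]
  have hk : (ShortComplex.mk _ _ km).Exact :=
    exact_sigmaShortComplex (fun q => ShortComplex.mk _ _ (km₀ q)) hkm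
  have monok (q : κ) : Mono (k q) := mono_comp _ _
  have kd : (Limits.Sigma.map k ≫ β₂) ≫ δ = 0 := by
    rw [Category.assoc, e₂', reassoc_of% km, zero_comp]
  have hkd : (ShortComplex.mk _ _ kd).Exact := by
    let φ : ShortComplex.mk _ _ km ⟶ ShortComplex.mk _ _ kd :=
      { τ₁ := 𝟙 _
        τ₂ := β₂
        τ₃ := γ
        comm₁₂ := Category.id_comp _
        comm₂₃ := e₂' }
    have : Epi φ.τ₁ := inferInstanceAs (Epi (𝟙 _))
    have : IsIso φ.τ₂ := iβ₂
    have : Mono φ.τ₃ := iγ.mono_of_iso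
    exact (ShortComplex.exact_iff_of_epi_of_isIso_of_mono φ).1 hk
  have ua : Limits.Sigma.map m ≫ α₁ ≫ α = 0 := by
    rw [← Category.assoc, ← e₁', Category.assoc, hδα, comp_zero]
  have hua : (ShortComplex.mk _ _ ua).Exact := by
    let φ : ShortComplex.mk _ _ ua ⟶ ShortComplex.mk _ _ hδα :=
      { τ₁ := β₁
        τ₂ := α₁
        τ₃ := 𝟙 _
        comm₁₂ := e₁'
        comm₂₃ := (Category.comp_id _).symm }
    have : Epi φ.τ₁ := iβ₁.epi_of_iso
    have : IsIso φ.τ₂ := iα₁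
    have : Mono φ.τ₃ := inferInstanceAs (Mono (𝟙 _))
    exact (ShortComplex.exact_iff_of_epi_of_isIso_of_mono φ).2 (hS.homology_exact₁ (n - 1) n rel)
  have ab : (α₁ ≫ α) ≫ β = 0 := by rw [Category.assoc, hαβ, comp_zero]
  have hab : (ShortComplex.mk _ _ ab).Exact := by
    let φ : ShortComplex.mk _ _ ab ⟶ ShortComplex.mk _ _ hαβ :=
      { τ₁ := α₁
        τ₂ := 𝟙 _
        τ₃ := 𝟙 _
        comm₁₂ := (Category.comp_id _).symm
        comm₂₃ := (Category.id_comp _).trans (Category.comp_id _).symm }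
    have : Epi φ.τ₁ := iα₁.epi_of_iso
    have : IsIso φ.τ₂ := inferInstanceAs (IsIso (𝟙 _))
    have : Mono φ.τ₃ := inferInstanceAs (Mono (𝟙 _))
    exact (ShortComplex.exact_iff_of_epi_of_isIso_of_mono φ).2 (hS.homology_exact₂ n)
  have : Epi (Limits.Sigma.map π) := Limits.Sigma.map_epi π
  have : Mono (Limits.Sigma.map k ≫ β₂) := mono_comp _ _
  obtain ⟨f, g, fg, hf, -, hfg⟩ := exists_shortExact_of_exact ua hua ab hab hβδ
    (hS.homology_exact₃ n (n + 1) rel') uq huq kd hkd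
  refine ⟨f, g, fg, hfg, fun p => ?_⟩
  rw [← cancel_epi (π p), homologyπ_crossHomology]
  have h₁ : Limits.Sigma.ι _ p ≫ Limits.Sigma.map π ≫ f = Limits.Sigma.ι _ p ≫ α₁ ≫ α :=
    congrArg (_ ≫ ·) hf
  rw [Limits.Sigma.ι_map_assoc, Limits.Sigma.ι_desc_assoc] at h₁
  rw [h₁]
  refine (cross_totMap (a p) (b p) n (h.add p) (cyclesIncl P) (𝟙 _) comp_zero).trans ?_
  have h₂ : 𝟙 ((cyclesComplex P).X (b p)) ≫ (cyclesIncl P).f (b p) = P.iCycles (b p) :=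
    Category.id_comp _
  simp only [h₂]

end

section

open HomologicalComplex

set_option linter.unusedSectionVars false

/-! ### Coproducts with one nonzero summand -/

lemma isZero_sigma {A : Type*} [Category* A] [HasZeroMorphisms A] {ι : Type*} {F : ι → A}
    [HasCoproduct F] (h : ∀ p, IsZero (F p)) : IsZero (∐ F) := by
  rw [IsZero.iff_id_eq_zero]
  exact Limits.Sigma.hom_ext _ _ fun p => (h p).eq_of_src _ _

lemma isIso_sigmaι {A : Type*} [Category* A] [HasZeroMorphisms A] {ι : Type*} {F : ι → A}
    [HasCoproduct F] (p : ι) (h : ∀ q, q ≠ p → IsZero (F q)) : IsIso (Limits.Sigma.ι F p) := by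
  classical
  refine ⟨Limits.Sigma.π F p, Sigma.ι_π_eq_id F p, Limits.Sigma.hom_ext _ _ fun q => ?_⟩
  obtain rfl | hq := eq_or_ne q p
  · rw [← Category.assoc, Sigma.ι_π_eq_id, Category.id_comp, Category.comp_id]
  · exact (h q hq).eq_of_src _ _

/-- The isomorphism of coproducts induced by a family of isomorphisms. -/
def sigmaMapIso {A : Type*} [Category* A] {ι : Type*} {F G : ι → A} [HasCoproduct F]
    [HasCoproduct G] (e : ∀ p, F p ≅ G p) : ∐ F ≅ ∐ G where
  hom := Limits.Sigma.map fun p => (e p).hom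
  inv := Limits.Sigma.map fun p => (e p).inv
  hom_inv_id := by ext; simp
  inv_hom_id := by ext; simp

/-! ### Invariance of the derived functor -/

section

variable {A : Type u} [Category.{v} A] [Abelian A]
  {T : A ⥤ A ⥤ A} [T.Additive] [∀ X, (T.obj X).Additive]
  [∀ X, PreservesFiniteColimits (T.obj X)] [∀ X, PreservesFiniteColimits (T.flip.obj X)]
  {flat : A → Prop} (h : FlatClass T flat)

include h in
lemma nonempty_kernel_cover_iso_tor₁ (X Y : A) :
    Nonempty (kernel ((T.obj X).map (kernel.ι (h.coverπ Y))) ≅ h.tor₁ X Y) :=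
  nonempty_kernel_iso_tor₁ h X (S := ShortComplex.mk _ _ (kernel.condition (h.coverπ Y)))
    { exact := ShortComplex.exact_of_f_is_kernel _ (kernelIsKernel _)
      mono_f := inferInstanceAs (Mono (kernel.ι _))
      epi_g := inferInstanceAs (Epi (h.coverπ Y)) } (h.flat_cover Y)

/-- The chosen cover of `X` does not vary functorially, so the change of first variable goes through
the description by a cover of `Y`. -/
lemma FlatClass.nonempty_tor₁_iso {X X' Y Y' : A} (e : X ≅ X') (e' : Y ≅ Y') :
    Nonempty (h.tor₁ X Y ≅ h.tor₁ X' Y') := by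
  obtain ⟨i⟩ := nonempty_kernel_cover_iso_tor₁ h X Y
  obtain ⟨i'⟩ := nonempty_kernel_cover_iso_tor₁ h X' Y
  exact ⟨i.symm ≪≫ kernel.mapIso _ _ ((T.mapIso e).app _) ((T.mapIso e).app _)
    ((T.map e.hom).naturality _) ≪≫ i' ≪≫
    kernel.mapIso _ _ ((T.obj _).mapIso e') ((T.obj _).mapIso e')
      ((T.map _).naturality e'.hom).symm⟩

lemma FlatClass.isZero_tor₁_left {X : A} (hX : IsZero X) (Y : A) : IsZero (h.tor₁ X Y) := by
  obtain ⟨i⟩ := nonempty_kernel_cover_iso_tor₁ h X Y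
  refine IsZero.of_iso ?_ i.symm
  refine IsZero.of_mono (kernel.ι _) ?_
  exact (T.flip.obj _).map_isZero hX

lemma FlatClass.isZero_tor₁_right (X : A) {Y : A} (hY : IsZero Y) : IsZero (h.tor₁ X Y) :=
  have : IsZero (kernel ((T.map (kernel.ι (h.coverπ X))).app Y)) :=
    IsZero.of_mono (kernel.ι _) ((T.obj _).map_isZero hY)
  this

end

/-! ### The Künneth sequence for sheaves -/

variable {C : Type u} [Category.{v} C] {J : GrothendieckTopology C}

variable (J) in
lemma flatClass_tensorSh : FlatClass (tensorSh J) TorsionFree where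
  left hP := hP.preservesMonomorphisms_flip
  right hP := hP.preservesMonomorphisms
  of_mono hP f _ := hP.of_mono f
  exists_epi G := exists_torsionFree_epi G

variable (R : ∀ Y : CochainComplex (AbSheaf J) ℤ, FlatResolution Y)
  (X Y : CochainComplex (AbSheaf J) ℤ)

/-- The identification of the homology of the flat resolution. -/
def resIso (j : ℤ) : (R Y).P.homology j ≅ Y.homology j :=
  have := (R Y).quasiIso.quasiIsoAt j
  isoOfQuasiIsoAt (R Y).π j

lemma resIso_hom_inv (j : ℤ) :
    homologyMap (R Y).π j ≫ (resIso R Y j).inv = 𝟙 _ := by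
  have := (R Y).quasiIso.quasiIsoAt j
  exact (isoOfQuasiIsoAt (R Y).π j).hom_inv_id

/-- The canonical product map. -/
def productMap (i j n : ℤ) (h : i + j = n) :
    tens (X.homology i) (Y.homology j) ⟶ (dtens R X Y).homology n :=
  ((tensorSh J).obj (X.homology i)).map (resIso R Y j).inv ≫
    crossHomology (tensorSh J) X (R Y).P i j n h

lemma isProductMap_productMap (i j n : ℤ) (h : i + j = n) :
    IsProductMap R X Y i j n h (productMap R X Y i j n h) := by
  refine ⟨crossCycles i j n h ((R Y).P.iCycles j) (iCycles_d _ j (j + 1)), ?_, ?_⟩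
  · rw [crossCycles_iCycles, Category.assoc]
  · have e : (R Y).P.homologyπ j ≫ homologyMap (R Y).π j ≫ (resIso R Y j).inv =
        (R Y).P.homologyπ j := by
      rw [resIso_hom_inv, Category.comp_id]
    rw [productMap, Category.assoc, ← Functor.map_comp_assoc, Category.assoc, e,
      homologyπ_crossHomology, homologyπ_cross]

/-- The Künneth sequence for complexes of sheaves. -/
lemma exists_kunneth_sheaf {ι κ : Type} {a b : ι → ℤ} {a' c' : κ → ℤ} {n : ℤ}
    (h : Antidiagonal a b n) (h' : Antidiagonal a' c' (n + 1)) :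
    ∃ (f : (∐ fun p => tens (X.homology (a p)) (Y.homology (b p))) ⟶ (dtens R X Y).homology n)
      (g : (dtens R X Y).homology n ⟶
        ∐ fun q => (flatClass_tensorSh J).tor₁ (X.homology (a' q)) (Y.homology (c' q)))
      (fg : f ≫ g = 0), (ShortComplex.mk f g fg).ShortExact ∧
      ∀ p, Limits.Sigma.ι (fun p => tens (X.homology (a p)) (Y.homology (b p))) p ≫ f =
        productMap R X Y (a p) (b p) n (h.add p) := by
  -- The given resolution has flat, hence torsion-free, terms; nothing else about it is needed here.
  obtain ⟨f, g, fg, hfg, hf⟩ := exists_kunneth_shortExact (flatClass_tensorSh J) X (R Y).P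
    (fun i => ((R Y).flat i).torsionFree) h h'
  let r (p : ι) := ((tensorSh J).obj (X.homology (a p))).mapIso (resIso R Y (b p))
  let e₁ := sigmaMapIso r
  let e₂ := Limits.Sigma.mapIso fun q => ((flatClass_tensorSh J).nonempty_tor₁_iso
    (Iso.refl (X.homology (a' q))) (resIso R Y (c' q))).some
  have w : (e₁.inv ≫ f) ≫ g ≫ e₂.hom = 0 := by
    rw [Category.assoc, reassoc_of% fg, zero_comp, comp_zero]
  let e : ShortComplex.mk f g fg ≅ ShortComplex.mk _ _ w :=
    ShortComplex.isoMk e₁ (Iso.refl _) e₂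
      ((e₁.hom_inv_id_assoc f).trans (Category.comp_id f).symm) (Category.id_comp _)
  refine ⟨e₁.inv ≫ f, g ≫ e₂.hom, w, ShortComplex.shortExact_of_iso e hfg, fun p => ?_⟩
  · have : Limits.Sigma.ι (fun p => tens (X.homology (a p)) (Y.homology (b p))) p ≫ e₁.inv =
        (r p).inv ≫ Limits.Sigma.ι (fun p => tens (X.homology (a p)) ((R Y).P.homology (b p))) p :=
      Limits.Sigma.ι_map (fun p => (r p).inv) p
    rw [reassoc_of% this, hf]
    rfl

/-! ### The derived tensor product of two sheaves -/

lemma isZero_homology_sgl (A : AbSheaf J) {i : ℤ} (hi : i ≠ 0) : IsZero ((sgl A).homology i) :=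
  (exactAt_single_obj (ComplexShape.up ℤ) 0 A i hi).isZero_homology

variable (A B : AbSheaf J)

lemma isZero_tens_homology_sgl {i j : ℤ} (h : i ≠ 0 ∨ j ≠ 0) :
    IsZero (tens ((sgl A).homology i) ((sgl B).homology j)) := by
  obtain h | h := h
  · exact ((tensorSh J).flip.obj _).map_isZero (isZero_homology_sgl A h)
  · exact ((tensorSh J).obj _).map_isZero (isZero_homology_sgl B h)

lemma isZero_tor₁_homology_sgl {i j : ℤ} (h : i ≠ 0 ∨ j ≠ 0) :
    IsZero ((flatClass_tensorSh J).tor₁ ((sgl A).homology i) ((sgl B).homology j)) := by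
  obtain h | h := h
  · exact (flatClass_tensorSh J).isZero_tor₁_left (isZero_homology_sgl A h) _
  · exact (flatClass_tensorSh J).isZero_tor₁_right _ (isZero_homology_sgl B h)

/-- Homology sits in degree `0` only, so the tensor part needs `-r = 0` and the `tor₁` part needs
`-r + 1 = 0`. -/
lemma isZero_tor {r : ℤ} (h₀ : r ≠ 0) (h₁ : r ≠ 1) : IsZero (tor R r A B) := by
  obtain ⟨f, g, fg, hfg, -⟩ := exists_kunneth_sheaf R (sgl A) (sgl B)
    (Antidiagonal.canonical (-r)) (Antidiagonal.canonical (-r + 1))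
  exact hfg.exact.isZero_of_both_zeros
    ((isZero_sigma fun p => isZero_tens_homology_sgl A B (by
      by_contra!
      have := p.2
      lia)).eq_of_src _ _)
    ((isZero_sigma fun p => isZero_tor₁_homology_sgl A B (by
      by_contra!
      have := p.2
      lia)).eq_of_tgt _ _)

lemma isIso_productMap_sgl (n : ℤ) (h : 0 + 0 = n) :
    IsIso (productMap R (sgl A) (sgl B) 0 0 n h) := by
  obtain ⟨f, g, fg, hfg, hf⟩ := exists_kunneth_sheaf R (sgl A) (sgl B)
    (Antidiagonal.canonical n) (Antidiagonal.canonical (n + 1))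
  have hg : g = 0 := (isZero_sigma fun p => isZero_tor₁_homology_sgl A B (by
    by_contra!
    have := p.2
    lia)).eq_of_tgt _ _
  have : Mono f := hfg.mono_f
  have : Epi f := hfg.exact.epi_f hg
  have : IsIso f := isIso_of_mono_of_epi f
  have := isIso_sigmaι (F := fun p : {q : ℤ × ℤ // q.1 + q.2 = n} =>
    tens ((sgl A).homology p.1.1) ((sgl B).homology p.1.2)) ⟨(0, 0), h⟩ fun q hq =>
      isZero_tens_homology_sgl A B (by
        by_contra!
        exact hq (Subtype.ext (Prod.ext this.1 this.2)))
  rw [← hf ⟨(0, 0), h⟩]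
  infer_instance

/-- The identification of `H⁰(A) ⊗ H⁰(B)` with `A ⊗ B`. -/
def tensHomologySglIso : tens ((sgl A).homology 0) ((sgl B).homology 0) ≅ tens A B :=
  ((tensorSh J).mapIso (singleObjHomologySelfIso (ComplexShape.up ℤ) 0 A)).app _ ≪≫
    ((tensorSh J).obj A).mapIso (singleObjHomologySelfIso (ComplexShape.up ℤ) 0 B)

/-- The canonical isomorphism of the tensor product with `Tor₀`. -/
def tensIsoTor : tens A B ≅ tor R 0 A B :=
  have := isIso_productMap_sgl R A B (-0) ((zero_add 0).trans neg_zero.symm)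
  (tensHomologySglIso A B).symm ≪≫ asIso (productMap R (sgl A) (sgl B) 0 0 (-0) ((zero_add 0).trans neg_zero.symm))

lemma isProductMap_tensIsoTor :
    IsProductMap R (sgl A) (sgl B) 0 0 (-0) ((zero_add 0).trans neg_zero.symm)
      (tensMap (singleObjHomologySelfIso (ComplexShape.up ℤ) 0 A).hom
        (singleObjHomologySelfIso (ComplexShape.up ℤ) 0 B).hom ≫ (tensIsoTor R A B).hom) := by
  have e := (tensHomologySglIso A B).hom_inv_id_assoc
    (productMap R (sgl A) (sgl B) 0 0 (-0) ((zero_add 0).trans neg_zero.symm))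
  exact e.symm ▸ isProductMap_productMap ..

/-- In cohomological degree `-1` the tensor part vanishes, and the `tor₁` part has `(0, 0)` as its
only possibly nonzero summand. -/
lemma nonempty_tor₁_iso_tor : Nonempty ((flatClass_tensorSh J).tor₁ A B ≅ tor R 1 A B) := by
  obtain ⟨f, g, fg, hfg, -⟩ := exists_kunneth_sheaf R (sgl A) (sgl B)
    (Antidiagonal.canonical (-1)) (Antidiagonal.canonical (-1 + 1))
  have hf : f = 0 := (isZero_sigma fun p => isZero_tens_homology_sgl A B (by
    by_contra!
    have := p.2
    lia)).eq_of_src _ _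
  have : Epi g := hfg.epi_g
  have : Mono g := hfg.exact.mono_g hf
  have : IsIso g := isIso_of_mono_of_epi g
  have := isIso_sigmaι (F := fun p : {q : ℤ × ℤ // q.1 + q.2 = -1 + 1} =>
    (flatClass_tensorSh J).tor₁ ((sgl A).homology p.1.1) ((sgl B).homology p.1.2))
      ⟨(0, 0), by simp⟩ fun q hq =>
        isZero_tor₁_homology_sgl A B (by
          by_contra!
          exact hq (Subtype.ext (Prod.ext this.1 this.2)))
  obtain ⟨e⟩ := (flatClass_tensorSh J).nonempty_tor₁_iso
    (singleObjHomologySelfIso (ComplexShape.up ℤ) 0 A)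
    (singleObjHomologySelfIso (ComplexShape.up ℤ) 0 B)
  exact ⟨e.symm ≪≫ @asIso _ _ _ _ _ this ≪≫ (asIso g).symm⟩

end

/-! ### Degenerate spectral sequences with two columns -/

section

variable {A : Type u} [Category.{v} A] [Abelian A]

section

variable {κ : Type*} (c : ComplexShape κ) (E : κ → A)

/-- The complex with objects `E` and zero differentials. -/
abbrev zeroPage : HomologicalComplex A c where
  X := E
  d _ _ := 0

/-- The homology of a complex with zero differentials. -/
def zeroPageHomologyIso (i : κ) : (zeroPage c E).homology i ≅ E i :=
  ((zeroPage c E).isoHomologyπ _ i rfl rfl).symm ≪≫ (zeroPage c E).iCyclesIso i _ rfl rfl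

lemma homologyπ_zeroPageHomologyIso (i : κ) :
    (zeroPage c E).homologyπ i ≫ (zeroPageHomologyIso c E i).hom = (zeroPage c E).iCycles i :=
  ((zeroPage c E).isoHomologyπ _ i rfl rfl).hom_inv_id_assoc _

end

/-- The spectral sequence with second page `E` and zero differentials. -/
abbrev degenerate (E : ℤ × ℤ → A) : HomologicalSpectralSequence A where
  page _ _ := zeroPage _ E
  iso _ _ a _ _ := zeroPageHomologyIso _ E a

lemma exists_cokernel_iso_of_eq_bot {E H : A} (f : E ⟶ H) [Mono f] {U V : Subobject H} (h : U ≤ V)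
    (hU : U = ⊥) (hV : V = Subobject.mk f) :
    ∃ i : cokernel (Subobject.ofLE U V h) ≅ E, cokernel.π _ ≫ i.hom ≫ f = V.arrow := by
  subst hU hV
  have h₀ : Subobject.ofLE ⊥ (Subobject.mk f) h = 0 := by
    rw [← cancel_mono (Subobject.mk f).arrow, Subobject.ofLE_arrow, Subobject.bot_arrow, zero_comp]
  have : IsIso (cokernel.π (Subobject.ofLE ⊥ (Subobject.mk f) h)) := by
    have : Mono (cokernel.π (Subobject.ofLE ⊥ (Subobject.mk f) h)) :=
      (ShortComplex.exact_cokernel _).mono_g h₀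
    exact isIso_of_mono_of_epi _
  refine ⟨(asIso (cokernel.π _)).symm ≪≫ Subobject.underlyingIso f, ?_⟩
  simp

lemma exists_cokernel_iso_of_eq_top {E E' H : A} (f : E ⟶ H) (g : H ⟶ E') (w : f ≫ g = 0)
    (hS : (ShortComplex.mk f g w).ShortExact) [Mono f] {U V : Subobject H} (h : U ≤ V)
    (hU : U = Subobject.mk f) (hV : V = ⊤) :
    ∃ i : cokernel (Subobject.ofLE U V h) ≅ E', V.arrow ≫ g = cokernel.π _ ≫ i.hom := by
  subst hU hV
  have w' : Subobject.ofLE (Subobject.mk f) ⊤ h ≫ (⊤ : Subobject H).arrow ≫ g = 0 := by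
    rw [Subobject.ofLE_arrow_assoc, ← Subobject.underlyingIso_hom_comp_eq_mk, Category.assoc, w,
      comp_zero]
  let e : ShortComplex.mk f g w ≅ ShortComplex.mk _ _ w' :=
    ShortComplex.isoMk (Subobject.underlyingIso f).symm (asIso (⊤ : Subobject H).arrow).symm
      (Iso.refl _) (by
        change (Subobject.underlyingIso f).inv ≫ Subobject.ofLE _ _ h =
          f ≫ inv (⊤ : Subobject H).arrow
        simp [IsIso.eq_comp_inv])
      (by simp)
  have hS' := ShortComplex.shortExact_of_iso e hS
  exact ⟨(cokernelIsCokernel _).coconePointUniqueUpToIso hS'.gIsCokernel,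
    ((cokernelIsCokernel _).comp_coconePointUniqueUpToIso_hom hS'.gIsCokernel .one).symm⟩

lemma nonempty_cokernel_iso_of_eq {E H : A} (hE : IsZero E) {U V : Subobject H} (h : U ≤ V)
    (hUV : U = V) : Nonempty (cokernel (Subobject.ofLE U V h) ≅ E) := by
  subst hUV
  rw [Subobject.ofLE_refl]
  exact ⟨(isZero_cokernel_of_epi (𝟙 (U : A))).iso hE⟩

variable {E : ℤ × ℤ → A} {H : ℤ → A} (f : ∀ n, E (0, n) ⟶ H n) (g : ∀ n, H n ⟶ E (1, n - 1))

/-- The filtration with the image of `f` in filtration degree `0`. -/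
def twoStepFiltration [∀ n, Mono (f n)] (n p : ℤ) : Subobject (H n) :=
  if p < 0 then ⊥ else if p = 0 then Subobject.mk (f n) else ⊤

section

variable [∀ n, Mono (f n)]

lemma twoStepFiltration_of_neg (n : ℤ) {p : ℤ} (hp : p < 0) : twoStepFiltration f n p = ⊥ :=
  if_pos hp

lemma twoStepFiltration_zero (n : ℤ) : twoStepFiltration f n 0 = Subobject.mk (f n) := rfl

lemma twoStepFiltration_of_pos (n : ℤ) {p : ℤ} (hp : 0 < p) : twoStepFiltration f n p = ⊤ :=
  (if_neg hp.le.not_gt).trans (if_neg hp.ne')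

lemma twoStepFiltration_le (n p : ℤ) : twoStepFiltration f n (p - 1) ≤ twoStepFiltration f n p := by
  obtain hp | hp := lt_or_ge 0 p
  · rw [twoStepFiltration_of_pos f n hp]
    exact le_top
  · rw [twoStepFiltration_of_neg f n (by lia)]
    exact bot_le

variable (w : ∀ n, f n ≫ g n = 0) (hS : ∀ n, (ShortComplex.mk _ _ (w n)).ShortExact)
  (hE : ∀ p q, p ≠ 0 → p ≠ 1 → IsZero (E (p, q)))

-- The graded pieces are the image of `f` for `p = 0`, the cokernel of `f` for `p = 1`, and zero
-- otherwise. The edge conditions are conditional equalities so that one choice serves all `(p, q)`.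
include hS hE in
lemma exists_gr_iso (n p q : ℤ) (h : p + q = n) :
    ∃ i : cokernel (Subobject.ofLE (twoStepFiltration f n (p - 1)) (twoStepFiltration f n p)
        (twoStepFiltration_le f n p)) ≅ E (p, q),
      (∀ (hp : p = 0) (hq : q = n), cokernel.π _ ≫ i.hom ≫ eqToHom (by rw [hp, hq]) ≫ f n =
        (twoStepFiltration f n p).arrow) ∧
      ∀ (hp : p = 1) (hq : q = n - 1), (twoStepFiltration f n p).arrow ≫ g n =
        cokernel.π _ ≫ i.hom ≫ eqToHom (by rw [hp, hq]) := by
  obtain rfl | h₀ := eq_or_ne p 0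
  · obtain rfl : q = n := by lia
    obtain ⟨i, hi⟩ := exists_cokernel_iso_of_eq_bot (f q) (twoStepFiltration_le f q 0)
      (twoStepFiltration_of_neg f q (by lia)) (twoStepFiltration_zero f q)
    exact ⟨i, fun _ _ => by simpa using hi, fun h => by simp at h⟩
  obtain rfl | h₁ := eq_or_ne p 1
  · obtain rfl : q = n - 1 := by lia
    obtain ⟨i, hi⟩ := exists_cokernel_iso_of_eq_top (f n) (g n) (w n) (hS n)
      (twoStepFiltration_le f n 1) (twoStepFiltration_zero f n)
      (twoStepFiltration_of_pos f n (by lia))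
    exact ⟨i, fun h => by simp at h, fun _ _ => by simpa using hi⟩
  · obtain ⟨i⟩ := nonempty_cokernel_iso_of_eq (hE p q h₀ h₁) (twoStepFiltration_le f n p) (by
      obtain hp | hp := lt_or_ge 0 p
      · rw [twoStepFiltration_of_pos f n hp, twoStepFiltration_of_pos f n (by lia)]
      · rw [twoStepFiltration_of_neg f n (by lia), twoStepFiltration_of_neg f n (by lia)])
    exact ⟨i, fun h => absurd h h₀, fun h => absurd h h₁⟩

/-- The convergence of the degenerate spectral sequence given by short exact sequences. -/
abbrev twoColumnConvergence : Convergence (degenerate E) H where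
  N _ := 2
  two_le _ := le_rfl
  d_to _ _ _ _ := rfl
  d_from _ _ _ _ := rfl
  Einf := E
  isoInf _ _ _ := Iso.refl _
  isoInf_comm a r hr := (Category.comp_id _).trans
    (((congrArg (_ ≫ ·) (Category.comp_id _)).trans (homologyπ_zeroPageHomologyIso _ E a)).symm)
  F := twoStepFiltration f
  F_le := twoStepFiltration_le f
  F_eq_bot n := ⟨-1, twoStepFiltration_of_neg f n (by lia)⟩
  F_eq_top n := ⟨1, twoStepFiltration_of_pos f n (by lia)⟩
  gr n p q h := (exists_gr_iso f g w hS hE n p q h).choose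

lemma toE₂_eq (n p q : ℤ) (h : p + q = n) :
    (twoColumnConvergence f g w hS hE).toE₂ n p q h le_rfl =
      cokernel.π _ ≫ (exists_gr_iso f g w hS hE n p q h).choose.hom :=
  congrArg (cokernel.π _ ≫ ·) (Category.comp_id _)

lemma toE₂_comp (n : ℤ) :
    (twoColumnConvergence f g w hS hE).toE₂ n 0 n (by simp) le_rfl ≫ f n =
      (twoStepFiltration f n 0).arrow := by
  have h := (exists_gr_iso f g w hS hE n 0 n (by simp)).choose_spec.1 rfl rfl
  rw [eqToHom_refl, Category.id_comp] at h
  exact ((congrArg (· ≫ f n) (toE₂_eq f g w hS hE n 0 n (by simp))).trans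
    (Category.assoc _ _ _)).trans h

lemma arrow_comp (n : ℤ) :
    (twoStepFiltration f n 1).arrow ≫ g n =
      (twoColumnConvergence f g w hS hE).toE₂ n 1 (n - 1) (by simp) le_rfl := by
  have h := (exists_gr_iso f g w hS hE n 1 (n - 1) (by simp)).choose_spec.2 rfl rfl
  rw [eqToHom_refl, Category.comp_id] at h
  exact h.trans (toE₂_eq f g w hS hE n 1 (n - 1) (by simp)).symm

end

end

/-! ### The Künneth sequence in homological indexing -/

section

variable {C : Type u} [Category.{v} C] {J : GrothendieckTopology C}
  (R : ∀ Y : CochainComplex (AbSheaf J) ℤ, FlatResolution Y)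
  (X Y : CochainComplex (AbSheaf J) ℤ)

lemma Antidiagonal.neg {s n : ℤ} (h : -s = n) :
    Antidiagonal (fun p : {p : ℤ × ℤ // p.1 + p.2 = s} => -p.1.1) (fun p => -p.1.2) n where
  add p := by have := p.2; lia
  bijective := by
    constructor
    · intro p q hpq
      simp only [Subtype.mk.injEq, Prod.mk.injEq, neg_inj] at hpq
      exact Subtype.ext (Prod.ext hpq.1 hpq.2)
    · rintro ⟨⟨i, j⟩, hij⟩
      exact ⟨⟨(-i, -j), by lia⟩, by simp⟩

lemma exists_kunneth_hl (n : ℤ) : ∃ (f : tensSum X Y n ⟶ hl (dtens R X Y) n)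
    (g : hl (dtens R X Y) n ⟶ torSum R X Y 1 (n - 1)) (fg : f ≫ g = 0),
    (ShortComplex.mk f g fg).ShortExact ∧ ∀ p : {p : ℤ × ℤ // p.1 + p.2 = n},
      IsProductMap R X Y (-p.1.1) (-p.1.2) (-n) ((neg_add _ _).symm.trans (congrArg Neg.neg p.2))
        (Limits.Sigma.ι (fun p : {p : ℤ × ℤ // p.1 + p.2 = n} =>
          tens (hl X p.1.1) (hl Y p.1.2)) p ≫ f) := by
  -- Cohomological total degree `-n + 1` of the `tor₁` part is homological degree `n - 1`.
  obtain ⟨f, g, fg, hfg, hf⟩ := exists_kunneth_sheaf R X Y (Antidiagonal.neg (rfl : -n = -n))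
    (Antidiagonal.neg (show -(n - 1) = -n + 1 by lia))
  let e := Limits.Sigma.mapIso fun p : {p : ℤ × ℤ // p.1 + p.2 = n - 1} =>
    (nonempty_tor₁_iso_tor R (hl X p.1.1) (hl Y p.1.2)).some
  have w : f ≫ g ≫ e.hom = 0 := by rw [reassoc_of% fg, zero_comp]
  let i : ShortComplex.mk f g fg ≅ ShortComplex.mk _ _ w :=
    ShortComplex.isoMk (Iso.refl _) (Iso.refl _) e
      ((Category.id_comp _).trans (Category.comp_id _).symm) (Category.id_comp _)
  refine ⟨f, g ≫ e.hom, w, ShortComplex.shortExact_of_iso i hfg, fun p => ?_⟩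
  rw [hf]
  exact isProductMap_productMap R X Y _ _ _ _

end

end

end Kunneth

/-! ### The main theorem -/

theorem mainTheorem7 {C : Type u} [Category.{v} C] (J : GrothendieckTopology C) :
    -- the Tor-dimension is at most one
    (∀ G : Kunneth.AbSheaf J, ∃ S : ShortComplex (Kunneth.AbSheaf J), S.ShortExact ∧
      Kunneth.IsFlat S.X₁ ∧ Kunneth.IsFlat S.X₂ ∧ Nonempty (S.X₃ ≅ G)) ∧
    -- every complex has a flat resolution
    (∀ Y : CochainComplex (Kunneth.AbSheaf J) ℤ, Nonempty (Kunneth.FlatResolution Y)) ∧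
    -- for every choice of flat resolutions, used to compute the derived tensor product and Tor:
    ∀ R : (∀ Y : CochainComplex (Kunneth.AbSheaf J) ℤ, Kunneth.FlatResolution Y),
      (∀ (A B : Kunneth.AbSheaf J) (r : ℤ), r ≠ 0 → r ≠ 1 → IsZero (Kunneth.tor R r A B)) ∧
      -- the canonical isomorphisms of the tensor product with `Tor_0`
      ∃ t : ∀ A B : Kunneth.AbSheaf J, Kunneth.tens A B ≅ Kunneth.tor R 0 A B,
        (∀ A B : Kunneth.AbSheaf J,
          Kunneth.IsProductMap R (Kunneth.sgl A) (Kunneth.sgl B) 0 0 (-0) (by simp)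
            (Kunneth.tensMap
              (HomologicalComplex.singleObjHomologySelfIso (ComplexShape.up ℤ) 0 A).hom
              (HomologicalComplex.singleObjHomologySelfIso (ComplexShape.up ℤ) 0 B).hom ≫
              (t A B).hom)) ∧
        ∀ X Y : CochainComplex (Kunneth.AbSheaf J) ℤ,
          -- the convergent spectral sequence
          ∃ (E : Kunneth.HomologicalSpectralSequence (Kunneth.AbSheaf J))
            (e : ∀ r s : ℤ, (E.page 2 le_rfl).X (r, s) ≅ Kunneth.torSum R X Y r s)
            (c : Kunneth.Convergence E (fun n => Kunneth.hl (Kunneth.dtens R X Y) n))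
            -- it collapses at the second page
            (hN : ∀ a : ℤ × ℤ, c.N a = 2),
            -- the exact sequences, given by the edge morphisms of the spectral sequence
            ∀ n : ℤ, ∃ (f : Kunneth.tensSum X Y n ⟶ Kunneth.hl (Kunneth.dtens R X Y) n)
              (g : Kunneth.hl (Kunneth.dtens R X Y) n ⟶ Kunneth.torSum R X Y 1 (n - 1))
              (hfg : f ≫ g = 0),
              (ShortComplex.mk f g hfg).ShortExact ∧
              c.toE₂ n 0 n (by simp) (hN _).le ≫ (e 0 n).hom ≫
                  Limits.Sigma.map (fun p => (t (Kunneth.hl X p.1.1) (Kunneth.hl Y p.1.2)).inv) ≫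
                    f = (c.F n 0).arrow ∧
              (c.F n 1).arrow ≫ g =
                c.toE₂ n 1 (n - 1) (by simp) (hN _).le ≫ (e 1 (n - 1)).hom ∧
              ∀ p : {p : ℤ × ℤ // p.1 + p.2 = n},
                Kunneth.IsProductMap R X Y (-p.1.1) (-p.1.2) (-n)
                  ((neg_add _ _).symm.trans (congrArg Neg.neg p.2))
                  (Limits.Sigma.ι (fun p : {p : ℤ × ℤ // p.1 + p.2 = n} =>
                    Kunneth.tens (Kunneth.hl X p.1.1) (Kunneth.hl Y p.1.2)) p ≫ f) := by 
  refine ⟨fun G => ?_, Kunneth.exists_flatResolution, fun R => ⟨fun A B r => ?_,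
    fun A B => Kunneth.tensIsoTor R A B, Kunneth.isProductMap_tensIsoTor R, fun X Y => ?_⟩⟩
  · obtain ⟨S, hS, h₁, h₂, rfl⟩ := Kunneth.exists_flat_presentation G
    exact ⟨S, hS, h₁.isFlat, h₂.isFlat, ⟨Iso.refl _⟩⟩
  · exact Kunneth.isZero_tor R A B
  · choose f g fg hfg hf using Kunneth.exists_kunneth_hl R X Y
    let t (n : ℤ) : Kunneth.torSum R X Y 0 n ≅ Kunneth.tensSum X Y n :=
      Kunneth.sigmaMapIso fun p => (Kunneth.tensIsoTor R (Kunneth.hl X p.1.1)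
        (Kunneth.hl Y p.1.2)).symm
    let E (a : ℤ × ℤ) := Kunneth.torSum R X Y a.1 a.2
    have hE (p q : ℤ) (h₀ : p ≠ 0) (h₁ : p ≠ 1) : IsZero (E (p, q)) :=
      Kunneth.isZero_sigma fun _ => Kunneth.isZero_tor R _ _ h₀ h₁
    -- Column `0` of `E²` consists of `Tor₀`, so the Künneth map is precomposed with the
    -- identification of `Tor₀` with the tensor product.
    let f' (n : ℤ) : E (0, n) ⟶ Kunneth.hl (Kunneth.dtens R X Y) n := (t n).hom ≫ f n
    let g' (n : ℤ) : Kunneth.hl (Kunneth.dtens R X Y) n ⟶ E (1, n - 1) := g n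
    have w (n : ℤ) : f' n ≫ g' n = 0 :=
      (Category.assoc _ _ _).trans ((congrArg ((t n).hom ≫ ·) (fg n)).trans comp_zero)
    have hS (n : ℤ) : (ShortComplex.mk _ _ (w n)).ShortExact := by
      let i : ShortComplex.mk _ _ (w n) ≅ ShortComplex.mk _ _ (fg n) :=
        ShortComplex.isoMk (t n) (Iso.refl _) (Iso.refl _) (Category.comp_id _).symm
          ((Category.id_comp _).trans (Category.comp_id _).symm)
      exact ShortComplex.shortExact_of_iso i.symm (hfg n)
    have (n : ℤ) : Mono (f' n) := (hS n).mono_f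
    refine ⟨Kunneth.degenerate E, fun r s => Iso.refl _,
      Kunneth.twoColumnConvergence f' g' w hS hE, fun _ => rfl, fun n =>
        ⟨f n, g n, fg n, hfg n, ?_, ?_, hf n⟩⟩
    · exact (congrArg (_ ≫ ·) (Category.id_comp _)).trans (Kunneth.toE₂_comp f' g' w hS hE n)
    · exact (Kunneth.arrow_comp f' g' w hS hE n).trans (Category.comp_id _).symm
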